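/- Let $\mathbb{K}$ be an algebraically closed field of characteristic $0$ and $\mathbb{P}^n$ the projective space over $\mathbb{K}$. Let $S(\mathbb{P}^n,x)$ be the set of all subsets of $\mathbb{P}^n$ of cardinality $x$ with its Zariski topology, let $\mathbb{P}^n[x]\subset(\mathbb{P}^n)^x$ be the set of $x$-tuples of pairwise distinct points, let $u_x:\mathbb{P}^n[x]\to S(\mathbb{P}^n,x)$ be the map that forgets the order, and for $y\le x$ let $\eta_y:\mathbb{P}^n[x]\to(\mathbb{P}^n)^y$ be the projection onto the first $y$ factors. The Terracini locus $\mathbb{T}(n,d;x)$ is the set of all $S\in S(\mathbb{P}^n,x)$ such that $\langle S\rangle=\mathbb{P}^n$, $h^0(\mathcal{I}_{2S}(d))>0$ and $h^1(\mathcal{I}_{2S}(d))>0$, where $2S$ is the union of the double points supported on $S$. For a non-empty irreducible locally closed set $K\subseteq S(\mathbb{P}^n,x)$, the spread $\eta(K)$ is the largest integer $y\le x$ such that $\eta_y(u_x^{-1}(K))$ contains a non-empty open subset of $(\mathbb{P}^n)^y$. **Theorem 3.8.** Let $n\ge 2$, $d\ge 3$ and $x$ be integers with $x\ge n+\lceil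 d/2\rceil$ and $(n+1)x\le\binom{n+d}{n}$. Then there is a non-empty irreducible set $K\subseteq\mathbb{T}(n,d;x)$, closed in $\mathbb{T}(n,d;x)$ and locally closed in $S(\mathbb{P}^n,x)$, such that $$\eta(K)=x-\lceil d/2\rceil+1\qquad\text{and}\qquad \dim K=\lceil d/2\rceil+n-1+n\left(x-\lceil d/2\rceil\right).$$ More precisely, $K$ can be taken to be the set of all $S\in S(\mathbb{P}^n,x)$ that span $\mathbb{P}^n$ and contain $\lceil d/2\rceil+1$ distinct collinear points. -/

import Mathlib

open scoped LinearAlgebra.Projectivization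

noncomputable section

namespace Terracini

/-- The projective space `ℙⁿ` (its set of `𝕜`-points), with homogeneous coordinates indexed by
`0, …, n`. -/
abbrev PSpace (𝕜 : Type*) [Field 𝕜] (n : ℕ) : Type _ := ℙ 𝕜 (Fin (n + 1) → 𝕜)

/-- The homogeneous coordinate ring `𝕜[X₀, …, Xₙ]` of `ℙⁿ`. -/
abbrev CoordRing (𝕜 : Type*) [Field 𝕜] (n : ℕ) : Type _ := MvPolynomial (Fin (n + 1)) 𝕜

/-! ### Zariski topologies -/

/-- The product `(ℙⁿ)ʸ`. It carries the Zariski topology defined below. -/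
def ProjPow (𝕜 : Type*) [Field 𝕜] (n y : ℕ) : Type _ := Fin y → PSpace 𝕜 n

/-- A polynomial in `y` blocks of `n + 1` variables that is homogeneous in each block of variables,
of degree `e i` in the block `i`. -/
def IsMultihomogeneous {𝕜 : Type*} [Field 𝕜] {n y : ℕ}
    (f : MvPolynomial (Fin y × Fin (n + 1)) 𝕜) (e : Fin y → ℕ) : Prop :=
  f.IsWeightedHomogeneous (fun k => (Pi.single k.1 1 : Fin y → ℕ)) e

/-- The locus in `(ℙⁿ)ʸ` where `f` does not vanish. For multihomogeneous `f` it does not depend on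
the choice of homogeneous coordinates of the points. -/
def nonvanishingLocus {𝕜 : Type*} [Field 𝕜] {n y : ℕ}
    (f : MvPolynomial (Fin y × Fin (n + 1)) 𝕜) : Set (ProjPow 𝕜 n y) :=
  {p | MvPolynomial.eval (fun k => (p k.1).rep k.2) f ≠ 0}

/-- The Zariski topology of `(ℙⁿ)ʸ`: the open sets are the unions of nonvanishing loci of
multihomogeneous polynomials. -/
instance (𝕜 : Type*) [Field 𝕜] (n y : ℕ) : TopologicalSpace (ProjPow 𝕜 n y) :=
  TopologicalSpace.generateFrom
    {U | ∃ (f : MvPolynomial (Fin y × Fin (n + 1)) 𝕜) (e : Fin y → ℕ),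
      IsMultihomogeneous f e ∧ U = nonvanishingLocus f}

/-- The set `ℙⁿ[x]` of `x`-tuples of pairwise distinct points, with the topology induced from
`(ℙⁿ)ˣ`. -/
abbrev DistinctTuples (𝕜 : Type*) [Field 𝕜] (n x : ℕ) : Type _ :=
  {p : ProjPow 𝕜 n x // Function.Injective (p : Fin x → PSpace 𝕜 n)}

/-- The set `S(ℙⁿ, x)` of subsets of `ℙⁿ` of cardinality `x`. -/
def PointSets (𝕜 : Type*) [Field 𝕜] (n x : ℕ) : Type _ :=
  {S : Finset (PSpace 𝕜 n) // S.card = x}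

/-- The map `u_x : ℙⁿ[x] → S(ℙⁿ, x)` that forgets the order of the points. -/
def forgetOrder {𝕜 : Type*} [Field 𝕜] {n x : ℕ} (p : DistinctTuples 𝕜 n x) : PointSets 𝕜 n x :=
  ⟨Finset.univ.map ⟨p.1, p.2⟩, by simp⟩

/-- The Zariski topology of `S(ℙⁿ, x)`, the quotient of the variety `ℙⁿ[x]` by the symmetric
group: it is the quotient topology. -/
instance (𝕜 : Type*) [Field 𝕜] (n x : ℕ) : TopologicalSpace (PointSets 𝕜 n x) :=
  TopologicalSpace.coinduced forgetOrder inferInstance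

/-! ### Double points and their cohomology -/

/-- The forms of degree `m` that are singular at every point of `A`, i.e. that vanish there together
with all their first partial derivatives. For `A = S` finite this is `H⁰(ℙⁿ, 𝓘_{2S}(m))`. -/
def doubleForms {𝕜 : Type*} [Field 𝕜] {n : ℕ} (A : Set (PSpace 𝕜 n)) (m : ℕ) :
    Submodule 𝕜 (CoordRing 𝕜 n) where
  carrier := {F | F.IsHomogeneous m ∧ ∀ p ∈ A,
    MvPolynomial.eval p.rep F = 0 ∧ ∀ j, MvPolynomial.eval p.rep (MvPolynomial.pderiv j F) = 0}
  add_mem' {F G} hF hG := ⟨hF.1.add hG.1, fun p hp => by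
    simp [hF.2 p hp, hG.2 p hp]⟩
  zero_mem' := ⟨MvPolynomial.isHomogeneous_zero _ _ _, by simp⟩
  smul_mem' c F hF := ⟨(MvPolynomial.homogeneousSubmodule (Fin (n + 1)) 𝕜 m).smul_mem c hF.1,
    fun p hp => by simp [hF.2 p hp]⟩

/-- The points of `S` in the standard open set `U_J = {p | p_j ≠ 0 for all j ∈ J}`. -/
def chartPoints {𝕜 : Type*} [Field 𝕜] {n : ℕ} (S : Finset (PSpace 𝕜 n))
    (J : Finset (Fin (n + 1))) : Set (PSpace 𝕜 n) :=
  {p | p ∈ S ∧ ∀ j ∈ J, p.rep j ≠ 0}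

/-- The monomial `∏_{j ∈ J} X_j`. -/
def chartMonomial (𝕜 : Type*) [Field 𝕜] {n : ℕ} (J : Finset (Fin (n + 1))) : CoordRing 𝕜 n :=
  ∏ j ∈ J, MvPolynomial.X j

lemma chartMonomial_isHomogeneous (𝕜 : Type*) [Field 𝕜] {n : ℕ} (J : Finset (Fin (n + 1)))
    (N : ℕ) : (chartMonomial 𝕜 J ^ N).IsHomogeneous (N * J.card) := by
  have h : (chartMonomial 𝕜 J).IsHomogeneous (∑ _j ∈ J, 1) :=
    MvPolynomial.IsHomogeneous.prod J _ _ (fun j _ => MvPolynomial.isHomogeneous_X 𝕜 j)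
  have h2 := h.pow N
  simpa [mul_comm] using h2

lemma mul_mem_doubleForms {𝕜 : Type*} [Field 𝕜] {n : ℕ} {A : Set (PSpace 𝕜 n)} {m k l : ℕ}
    {F G : CoordRing 𝕜 n} (hF : F ∈ doubleForms A m) (hG : G.IsHomogeneous k) (hl : m + k = l) :
    F * G ∈ doubleForms A l := by
  subst hl
  refine ⟨hF.1.mul hG, fun p hp => ?_⟩
  simp [(hF.2 p hp).1, (hF.2 p hp).2, Derivation.leibniz]

/-- The sections `Γ(U_J, 𝓘_{2S}(d))`, as a subspace of the field of rational functions in the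
homogeneous coordinates: the fractions `F / (∏_{j ∈ J} X_j) ^ N`, homogeneous of degree `d`, whose
numerator is singular at every point of `S ∩ U_J`. -/
def chartSections {𝕜 : Type*} [Field 𝕜] {n : ℕ} (S : Finset (PSpace 𝕜 n)) (d : ℕ)
    (J : Finset (Fin (n + 1))) : Submodule 𝕜 (FractionRing (CoordRing 𝕜 n)) where
  carrier := {g | ∃ (N : ℕ) (F : CoordRing 𝕜 n), F ∈ doubleForms (chartPoints S J) (d + N * J.card) ∧
    g * algebraMap (CoordRing 𝕜 n) (FractionRing (CoordRing 𝕜 n)) (chartMonomial 𝕜 J ^ N) =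
      algebraMap (CoordRing 𝕜 n) (FractionRing (CoordRing 𝕜 n)) F}
  add_mem' := by
    rintro g h ⟨N, F, hF, hg⟩ ⟨M, G, hG, hh⟩
    refine ⟨N + M, F * chartMonomial 𝕜 J ^ M + G * chartMonomial 𝕜 J ^ N,
      Submodule.add_mem _ (mul_mem_doubleForms hF (chartMonomial_isHomogeneous 𝕜 J M) (by ring))
        (mul_mem_doubleForms hG (chartMonomial_isHomogeneous 𝕜 J N) (by ring)), ?_⟩
    rw [pow_add, map_add, map_mul, map_mul, map_mul, ← hg, ← hh]
    ring
  zero_mem' := ⟨0, 0, Submodule.zero_mem _, by simp⟩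
  smul_mem' := by
    rintro c g ⟨N, F, hF, hg⟩
    refine ⟨N, c • F, Submodule.smul_mem _ c hF, ?_⟩
    rw [smul_mul_assoc, hg, Algebra.smul_def, Algebra.smul_def, map_mul]
    rw [← IsScalarTower.algebraMap_apply]

/-- The Čech `1`-cocycles of `𝓘_{2S}(d)` for the standard affine cover `U_0, …, U_n` of `ℙⁿ`:
families `g i j ∈ Γ(U_i ∩ U_j, 𝓘_{2S}(d))` with `g i j + g j k = g i k`. -/
def cocycles {𝕜 : Type*} [Field 𝕜] {n : ℕ} (S : Finset (PSpace 𝕜 n)) (d : ℕ) :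
    Submodule 𝕜 (Fin (n + 1) → Fin (n + 1) → FractionRing (CoordRing 𝕜 n)) where
  carrier := {g | (∀ i j, g i j ∈ chartSections S d {i, j}) ∧ ∀ i j k, g i j + g j k = g i k}
  add_mem' {g h} hg hh := ⟨fun i j => Submodule.add_mem _ (hg.1 i j) (hh.1 i j), fun i j k => by
    simp only [Pi.add_apply, ← hg.2 i j k, ← hh.2 i j k]; ring⟩
  zero_mem' := ⟨fun _ _ => Submodule.zero_mem _, by simp⟩
  smul_mem' c g hg := ⟨fun i j => Submodule.smul_mem _ c (hg.1 i j), fun i j k => by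
    simp only [Pi.smul_apply, ← hg.2 i j k, smul_add]⟩

/-- The Čech `1`-coboundaries `g i j = h j - h i`, with `h i ∈ Γ(U_i, 𝓘_{2S}(d))`. -/
def coboundaries {𝕜 : Type*} [Field 𝕜] {n : ℕ} (S : Finset (PSpace 𝕜 n)) (d : ℕ) :
    Submodule 𝕜 (Fin (n + 1) → Fin (n + 1) → FractionRing (CoordRing 𝕜 n)) where
  carrier := {g | ∃ h : Fin (n + 1) → FractionRing (CoordRing 𝕜 n),
    (∀ i, h i ∈ chartSections S d {i}) ∧ ∀ i j, g i j = h j - h i}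
  add_mem' := by
    rintro g g' ⟨h, hh, hg⟩ ⟨h', hh', hg'⟩
    refine ⟨h + h', fun i => Submodule.add_mem _ (hh i) (hh' i), fun i j => ?_⟩
    simp only [Pi.add_apply, hg, hg']; ring
  zero_mem' := ⟨0, fun _ => Submodule.zero_mem _, by simp⟩
  smul_mem' := by
    rintro c g ⟨h, hh, hg⟩
    exact ⟨c • h, fun i => Submodule.smul_mem _ c (hh i), fun i j => by
      simp only [Pi.smul_apply, hg, smul_sub]⟩

/-- The cohomology `H¹(ℙⁿ, 𝓘_{2S}(d))`, computed by the Čech complex of the standard affine cover. -/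
abbrev H1 {𝕜 : Type*} [Field 𝕜] {n : ℕ} (S : Finset (PSpace 𝕜 n)) (d : ℕ) : Type _ :=
  cocycles S d ⧸ (coboundaries S d).submoduleOf (cocycles S d)

/-- The number `h⁰(𝓘_{2S}(d))`. -/
def h0 {𝕜 : Type*} [Field 𝕜] {n : ℕ} (S : Finset (PSpace 𝕜 n)) (d : ℕ) : Cardinal :=
  Module.rank 𝕜 (doubleForms (S : Set (PSpace 𝕜 n)) d)

/-- The number `h¹(𝓘_{2S}(d))`. -/
def h1 {𝕜 : Type*} [Field 𝕜] {n : ℕ} (S : Finset (PSpace 𝕜 n)) (d : ℕ) : Cardinal :=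
  Module.rank 𝕜 (H1 S d)

/-! ### The Terracini locus, the spread, and point sets with many collinear points -/

/-- The finite set `S` spans `ℙⁿ`. -/
def Spans {𝕜 : Type*} [Field 𝕜] {n : ℕ} (S : Finset (PSpace 𝕜 n)) : Prop :=
  Projectivization.Subspace.span (S : Set (PSpace 𝕜 n)) = ⊤

/-- The Terracini locus `𝕋(n, d; x) ⊆ S(ℙⁿ, x)`. -/
def terraciniLocus (𝕜 : Type*) [Field 𝕜] (n d x : ℕ) : Set (PointSets 𝕜 n x) :=
  {S | Spans S.1 ∧ 0 < h0 S.1 d ∧ 0 < h1 S.1 d}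

/-- The projection of `ℙⁿ[x]` onto the first `y` factors. -/
def firstFactors {𝕜 : Type*} [Field 𝕜] {n x y : ℕ} (h : y ≤ x) (p : DistinctTuples 𝕜 n x) :
    ProjPow 𝕜 n y :=
  fun i => p.1 (Fin.castLE h i)

/-- `HasSpread K y` says that `η(K) = y`: `y` is the largest integer `≤ x` such that the image of
`u_x⁻¹(K)` under the projection to the first `y` factors contains a nonempty open subset of
`(ℙⁿ)ʸ`. -/
def HasSpread {𝕜 : Type*} [Field 𝕜] {n x : ℕ} (K : Set (PointSets 𝕜 n x)) (y : ℕ) : Prop :=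
  IsGreatest {z : ℕ | ∃ h : z ≤ x, ∃ U : Set (ProjPow 𝕜 n z), IsOpen U ∧ U.Nonempty ∧
    U ⊆ firstFactors h '' (forgetOrder ⁻¹' K)} y

/-- The finite set `S` contains `k` distinct collinear points. -/
def ContainsCollinear {𝕜 : Type*} [Field 𝕜] {n : ℕ} (S : Finset (PSpace 𝕜 n)) (k : ℕ) : Prop :=
  ∃ A ⊆ S, A.card = k ∧ Projectivization.IsCollinear (A : Set (PSpace 𝕜 n))

end Terracini

end

/-! Write c = ⌈d/2⌉. Of the rounding only d ≤ 2c is used, together with c ≥ 1 and n + c ≤ x.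

Terracini locus. Restrict a form of degree d to the line through c + 1 points of S. If the form is
singular at c of them and vanishes at the last one, the restriction has at least 2c + 1 > d zeros
with multiplicity, so it is zero, and the derivative along the line vanishes at the last point too
(`sum_mul_eval_pderiv_eq_zero`). Hence some first-order jet at a point of S is missed by all forms
of degree d singular at the other points (`exists_jet_obstruction`). So the gradient map from forms
of degree d to jets on S is not surjective. Its target has dimension (n+1)x, at most that of the
source, so it is not injective either, and h⁰ > 0. The missed jet also yields a Čech class: local
sections of degree d with this jet differ by sections of the ideal sheaf, and a coboundary would
correct them to a global form having the jet (`h1_pos_of_jet_obstruction`).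

Topology. K is the image, under the map forgetting the order, of the spanning tuples of distinct
points whose first c + 1 points lie on the line through the first two (`collinearLocus_eq`).
Spanning is open, collinearity is closed, and the forgetful map is closed since its fibres are
orbits of a finite group. Any two such tuples lie on a polynomial curve of such tuples, whence
irreducibility.

Dimension. For the upper bound, the cone over these tuples is dominated by an affine space: c - 1
points need two coefficients each, the others n + 1 coordinates. Dimensions of cone coordinate
rings, minus x, give a strictly monotone rank on irreducible closed sets (`exists_strictMono_rank`),
and the bound descends along the closed forgetful map. For the lower bound, affine parameters are
frozen one by one; the resulting irreducible sets are separated by symmetric hyperplane conditions.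

Spread. A spanning tuple of x - c + 1 points extends by c - 1 points on the line through its first
two. With more prescribed points, three of the collinear ones would be among them, which fails for
generic points since n ≥ 2. -/

noncomputable section

namespace Terracini

/-! ### The Zariski topology on products of projective spaces. -/

section ZariskiTopology

variable {𝕜 : Type*} [Field 𝕜] {n y : ℕ}

lemma weight_single_apply (d : Fin y × Fin (n + 1) →₀ ℕ) (i : Fin y) :
    Finsupp.weight (fun k : Fin y × Fin (n + 1) => (Pi.single k.1 1 : Fin y → ℕ)) d i =
      ∑ j, d (i, j) := by
  rw [Finsupp.weight_apply, Finsupp.sum_fintype _ _ (by simp), Finset.sum_apply,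
    Fintype.sum_prod_type, Finset.sum_eq_single i]
  · simp
  · intro b _ hb
    simp [hb.symm]
  · simp

/-- Every monomial has degree `e i` in block `i`, so each one scales by the same factor. Scalars in
an algebra are allowed because `coneHom` scales by polynomial variables. -/
lemma IsMultihomogeneous.eval₂_smul {A : Type*} [CommRing A] [Algebra 𝕜 A]
    {f : MvPolynomial (Fin y × Fin (n + 1)) 𝕜} {e : Fin y → ℕ}
    (hf : IsMultihomogeneous f e) (l : Fin y → A) (a : Fin y × Fin (n + 1) → A) :
    MvPolynomial.aeval (fun k => l k.1 * a k) f = (∏ i, l i ^ e i) * MvPolynomial.aeval a f := by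
  rw [MvPolynomial.aeval_eq_eval₂Hom, MvPolynomial.aeval_eq_eval₂Hom]
  simp only [MvPolynomial.coe_eval₂Hom, MvPolynomial.eval₂_eq']
  rw [Finset.mul_sum]
  refine Finset.sum_congr rfl fun d hd => ?_
  have hw := hf (MvPolynomial.mem_support_iff.1 hd)
  have : ∏ k : Fin y × Fin (n + 1), (l k.1 * a k) ^ d k =
      (∏ i, l i ^ e i) * ∏ k, a k ^ d k := by
    simp_rw [mul_pow]
    rw [Finset.prod_mul_distrib]
    congr 1
    rw [Fintype.prod_prod_type]
    refine Finset.prod_congr rfl fun i _ => ?_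
    dsimp only
    rw [Finset.prod_pow_eq_pow_sum, ← weight_single_apply, hw]
  rw [this]
  ring

lemma IsMultihomogeneous.eval_smul {f : MvPolynomial (Fin y × Fin (n + 1)) 𝕜} {e : Fin y → ℕ}
    (hf : IsMultihomogeneous f e) (l : Fin y → 𝕜) (a : Fin y × Fin (n + 1) → 𝕜) :
    MvPolynomial.eval (fun k => l k.1 * a k) f = (∏ i, l i ^ e i) * MvPolynomial.eval a f := by
  simpa [MvPolynomial.aeval_eq_eval] using hf.eval₂_smul l a

/-- The point of `(ℙⁿ)ʸ` with given homogeneous coordinates. -/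
def mkTuple (a : Fin y → Fin (n + 1) → 𝕜) (ha : ∀ i, a i ≠ 0) : ProjPow 𝕜 n y :=
  fun i => Projectivization.mk 𝕜 (a i) (ha i)

lemma mkTuple_apply (a : Fin y → Fin (n + 1) → 𝕜) (ha : ∀ i, a i ≠ 0) (i : Fin y) :
    mkTuple a ha i = Projectivization.mk 𝕜 (a i) (ha i) := rfl

lemma mkTuple_rep (p : ProjPow 𝕜 n y) :
    mkTuple (fun i => (p i).rep) (fun i => (p i).rep_nonzero) = p := by
  funext i
  exact Projectivization.mk_rep _

lemma mkTuple_eq_of_rep {a : Fin y → Fin (n + 1) → 𝕜} (ha : ∀ i, a i ≠ 0) {p : ProjPow 𝕜 n y}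
    (h : a = fun i => (p i).rep) : mkTuple a ha = p := by
  subst h
  exact mkTuple_rep p

lemma mkTuple_mem_nonvanishingLocus {f : MvPolynomial (Fin y × Fin (n + 1)) 𝕜} {e : Fin y → ℕ}
    (hf : IsMultihomogeneous f e) (a : Fin y → Fin (n + 1) → 𝕜) (ha : ∀ i, a i ≠ 0) :
    mkTuple a ha ∈ nonvanishingLocus f ↔ MvPolynomial.eval (fun k => a k.1 k.2) f ≠ 0 := by
  choose l hl using fun i => Projectivization.exists_smul_eq_mk_rep 𝕜 (a i) (ha i)
  have h : (fun k : Fin y × Fin (n + 1) => (mkTuple a ha k.1).rep k.2) =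
      fun k => (l k.1 : 𝕜) * a k.1 k.2 := by
    funext k
    rw [mkTuple_apply, ← hl]
    rfl
  have h2 : (∏ i, (l i : 𝕜) ^ e i) ≠ 0 :=
    Finset.prod_ne_zero_iff.2 fun i _ => pow_ne_zero _ (l i).ne_zero
  change MvPolynomial.eval _ f ≠ 0 ↔ _
  rw [h, hf.eval_smul (fun i => (l i : 𝕜)) (fun k => a k.1 k.2)]
  simp [h2]

lemma isOpen_nonvanishingLocus {f : MvPolynomial (Fin y × Fin (n + 1)) 𝕜} {e : Fin y → ℕ}
    (hf : IsMultihomogeneous f e) : IsOpen (nonvanishingLocus f) :=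
  TopologicalSpace.isOpen_generateFrom_of_mem ⟨f, e, hf, rfl⟩

lemma exists_nonvanishingLocus_subset {U : Set (ProjPow 𝕜 n y)} (hU : IsOpen U)
    {p : ProjPow 𝕜 n y} (hp : p ∈ U) :
    ∃ (f : MvPolynomial (Fin y × Fin (n + 1)) 𝕜) (e : Fin y → ℕ), IsMultihomogeneous f e ∧
      p ∈ nonvanishingLocus f ∧ nonvanishingLocus f ⊆ U := by
  have hb := TopologicalSpace.isTopologicalBasis_of_subbasis_of_inter
    (r := {U : Set (ProjPow 𝕜 n y) | ∃ (f : MvPolynomial (Fin y × Fin (n + 1)) 𝕜)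
      (e : Fin y → ℕ), IsMultihomogeneous f e ∧ U = nonvanishingLocus f}) rfl (by
    rintro _ ⟨f, e, hf, rfl⟩ _ ⟨g, e', hg, rfl⟩
    refine ⟨f * g, e + e', MvPolynomial.IsWeightedHomogeneous.mul hf hg, ?_⟩
    ext p
    simp [nonvanishingLocus])
  obtain ⟨V, hV, hpV, hVU⟩ := hb.exists_subset_of_mem_open hp hU
  rcases hV with rfl | ⟨f, e, hf, rfl⟩
  -- The basis built from the subbasis also contains the whole space, which is the nonvanishing
  -- locus of 1.
  · exact ⟨1, 0, MvPolynomial.isWeightedHomogeneous_one _ _, by simp [nonvanishingLocus],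
      (Set.subset_univ _).trans hVU⟩
  · exact ⟨f, e, hf, hpV, hVU⟩

/-- The matrix of linear forms `∑ₖ X_{(e i, k)} B k j`. -/
def genericMatrix {m : ℕ} (e : Fin m → Fin y) (B : Matrix (Fin (n + 1)) (Fin m) 𝕜) :
    Matrix (Fin m) (Fin m) (MvPolynomial (Fin y × Fin (n + 1)) 𝕜) :=
  fun i j => ∑ k, MvPolynomial.C (B k j) * MvPolynomial.X (e i, k)

lemma isMultihomogeneous_det_genericMatrix {m : ℕ} (e : Fin m → Fin y)
    (B : Matrix (Fin (n + 1)) (Fin m) 𝕜) :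
    IsMultihomogeneous (genericMatrix e B).det (∑ i, Pi.single (e i) 1) := by
  rw [Matrix.det_apply']
  refine MvPolynomial.IsWeightedHomogeneous.sum _ _ _ fun σ _ => ?_
  have h : MvPolynomial.IsWeightedHomogeneous
      (fun k : Fin y × Fin (n + 1) => (Pi.single k.1 1 : Fin y → ℕ))
      (∏ i, genericMatrix e B (σ i) i) (∑ i, Pi.single (e (σ i)) 1) := by
    refine MvPolynomial.IsWeightedHomogeneous.prod _ _ _ fun i _ => ?_
    refine MvPolynomial.IsWeightedHomogeneous.sum _ _ _ fun k _ => ?_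
    exact MvPolynomial.IsWeightedHomogeneous.C_mul
      (MvPolynomial.isWeightedHomogeneous_X 𝕜 _ (e (σ i), k)) _
  -- Row `i` is linear in block `e i`, and a permutation uses every row once, so the multidegree
  -- does not depend on `σ`.
  rw [Equiv.sum_comp σ (fun i => (Pi.single (e i) 1 : Fin y → ℕ))] at h
  have := MvPolynomial.IsWeightedHomogeneous.C_mul h ((Equiv.Perm.sign σ : ℤ) : 𝕜)
  simpa using this

lemma eval_det_genericMatrix {m : ℕ} (e : Fin m → Fin y) (B : Matrix (Fin (n + 1)) (Fin m) 𝕜)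
    (a : Fin y → Fin (n + 1) → 𝕜) :
    MvPolynomial.eval (fun k => a k.1 k.2) (genericMatrix e B).det =
      ((Matrix.of fun i => a (e i)) * B).det := by
  rw [RingHom.map_det]
  congr 1
  ext i j
  simp [genericMatrix, Matrix.mul_apply, mul_comm]

/-- A left inverse of the linear combination map supplies `B`. Letting `B` vary over all matrices
avoids selecting maximal minors and exhibits independence as a union of nonvanishing loci of
determinants. -/
lemma linearIndependent_iff_exists_det {m N : ℕ} (v : Fin m → Fin N → 𝕜) :
    LinearIndependent 𝕜 v ↔ ∃ B : Matrix (Fin N) (Fin m) 𝕜, ((Matrix.of v) * B).det ≠ 0 := by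
  constructor
  · intro h
    obtain ⟨g, hg⟩ := LinearMap.exists_leftInverse_of_injective (Fintype.linearCombination 𝕜 v)
      (LinearMap.ker_eq_bot.2 h.fintypeLinearCombination_injective)
    refine ⟨(LinearMap.toMatrix' g).transpose, ?_⟩
    have : Matrix.of v * (LinearMap.toMatrix' g).transpose = 1 := by
      refine Matrix.ext_of_single_vecMul fun i => ?_
      rw [← Matrix.vecMul_vecMul, Matrix.vecMul_transpose, LinearMap.toMatrix'_mulVec,
        Matrix.vecMul_one, Matrix.single_one_vecMul]
      have := LinearMap.congr_fun hg (Pi.single i 1)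
      simpa using this
    simp [this]
  · rintro ⟨B, hB⟩
    have h1 : LinearIndependent 𝕜 ((Matrix.of v) * B).row :=
      Matrix.linearIndependent_rows_of_det_ne_zero hB
    refine LinearIndependent.of_comp (Matrix.vecMulLinear B) ?_
    convert h1 using 1
    funext i
    simp only [Matrix.row, Matrix.mul_apply_eq_vecMul]
    rfl

/-- The locus where the points with indices `e 0, …, e (m - 1)` are linearly independent. -/
def independentLocus (𝕜 : Type*) [Field 𝕜] (n : ℕ) {y m : ℕ} (e : Fin m → Fin y) :
    Set (ProjPow 𝕜 n y) :=
  {p | LinearIndependent 𝕜 fun i => (p (e i)).rep}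

lemma isOpen_independentLocus {m : ℕ} (e : Fin m → Fin y) :
    IsOpen (independentLocus 𝕜 n e) := by
  have : independentLocus 𝕜 n e = ⋃ B, nonvanishingLocus (genericMatrix e B).det := by
    ext p
    simp only [independentLocus, Set.mem_ofPred_eq, Set.mem_iUnion, nonvanishingLocus,
      linearIndependent_iff_exists_det]
    refine exists_congr fun B => ?_
    rw [eval_det_genericMatrix e B fun i => (p i).rep]
  rw [this]
  exact isOpen_iUnion fun B =>
    isOpen_nonvanishingLocus (isMultihomogeneous_det_genericMatrix e B)

lemma linearIndependent_rep_mk_iff {ι : Type*} {V : Type*} [AddCommGroup V] [Module 𝕜 V]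
    (v : ι → V) (hv : ∀ i, v i ≠ 0) :
    LinearIndependent 𝕜 (fun i => (Projectivization.mk 𝕜 (v i) (hv i)).rep) ↔
      LinearIndependent 𝕜 v := by
  choose l hl using fun i => Projectivization.exists_smul_eq_mk_rep 𝕜 (v i) (hv i)
  have : (fun i => (Projectivization.mk 𝕜 (v i) (hv i)).rep) = l • v := by
    funext i
    exact (hl i).symm
  rw [this, LinearIndependent.units_smul_iff]

lemma mkTuple_mem_independentLocus {m : ℕ} (e : Fin m → Fin y) (a : Fin y → Fin (n + 1) → 𝕜)
    (ha : ∀ i, a i ≠ 0) :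
    mkTuple a ha ∈ independentLocus 𝕜 n e ↔ LinearIndependent 𝕜 fun i => a (e i) :=
  linearIndependent_rep_mk_iff (fun i => a (e i)) fun i => ha (e i)

lemma mem_independentLocus_pair (i j : Fin y) (p : ProjPow 𝕜 n y) :
    p ∈ independentLocus 𝕜 n ![i, j] ↔ p i ≠ p j := by
  rw [← Projectivization.linearIndependent_pair_iff_ne]
  change LinearIndependent 𝕜 _ ↔ _
  congr! 1
  funext k
  fin_cases k <;> rfl

lemma isOpen_injective :
    IsOpen {p : ProjPow 𝕜 n y | Function.Injective (p : Fin y → PSpace 𝕜 n)} := by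
  have : {p : ProjPow 𝕜 n y | Function.Injective (p : Fin y → PSpace 𝕜 n)} =
      ⋂ (i : Fin y) (j : Fin y) (_ : i ≠ j), independentLocus 𝕜 n ![i, j] := by
    ext p
    simp only [Set.mem_iInter, mem_independentLocus_pair]
    exact ⟨fun h i j hij he => hij (h he), fun h i j he => by_contra fun hij => h i j hij he⟩
  rw [this]
  exact isOpen_iInter_of_finite fun i => isOpen_iInter_of_finite fun j =>
    isOpen_iInter_of_finite fun _ => isOpen_independentLocus _

/-- The polynomial curve `s ↦ P(s)` in the space of coordinate vectors. -/
def curveAt (P : Fin y → Fin (n + 1) → Polynomial 𝕜) (s : 𝕜) : Fin y → Fin (n + 1) → 𝕜 :=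
  fun i k => (P i k).eval s

lemma eval_aeval_curve (P : Fin y → Fin (n + 1) → Polynomial 𝕜)
    (f : MvPolynomial (Fin y × Fin (n + 1)) 𝕜) (s : 𝕜) :
    (MvPolynomial.aeval (fun k => P k.1 k.2) f).eval s =
      MvPolynomial.eval (fun k => curveAt P s k.1 k.2) f := by
  rw [← Polynomial.coe_evalRingHom, MvPolynomial.aeval_def, MvPolynomial.hom_eval₂,
    MvPolynomial.eval, MvPolynomial.coe_eval₂Hom]
  congr 1
  ext x
  simp

lemma exists_eval_ne_zero [Infinite 𝕜] (f : Polynomial 𝕜) (hf : f ≠ 0) : ∃ s, f.eval s ≠ 0 := by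
  by_contra! h
  exact hf (Polynomial.funext fun s => by simpa using h s)

/-- Pulled back to the curve, the two open sets contain nonvanishing loci of nonzero polynomials in
one variable, and over an infinite field finitely many such loci meet. The factor `g` carries an
additional open condition on the parameter. -/
lemma exists_curveAt_mem [Infinite 𝕜] (P : Fin y → Fin (n + 1) → Polynomial 𝕜) {s₁ s₂ : 𝕜}
    (h₁ : ∀ i, curveAt P s₁ i ≠ 0) (h₂ : ∀ i, curveAt P s₂ i ≠ 0) {U V : Set (ProjPow 𝕜 n y)}
    (hU : IsOpen U) (hV : IsOpen V) (hU₁ : mkTuple _ h₁ ∈ U) (hV₂ : mkTuple _ h₂ ∈ V)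
    (g : Polynomial 𝕜) (hg : g ≠ 0) :
    ∃ (s : 𝕜) (h : ∀ i, curveAt P s i ≠ 0), mkTuple _ h ∈ U ∩ V ∧ g.eval s ≠ 0 := by
  obtain ⟨f₁, e₁, hf₁, hp₁, hs₁⟩ := exists_nonvanishingLocus_subset hU hU₁
  obtain ⟨f₂, e₂, hf₂, hp₂, hs₂⟩ := exists_nonvanishingLocus_subset hV hV₂
  rw [mkTuple_mem_nonvanishingLocus hf₁, ← eval_aeval_curve] at hp₁
  rw [mkTuple_mem_nonvanishingLocus hf₂, ← eval_aeval_curve] at hp₂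
  have hP : ∀ i, ∃ k, P i k ≠ 0 := fun i => by
    obtain ⟨k, hk⟩ := Function.ne_iff.1 (h₁ i)
    refine ⟨k, fun h => hk ?_⟩
    simp [curveAt, h]
  choose k hk using hP
  -- The product over `i` keeps one coordinate of each point nonzero, so that the curve defines a
  -- tuple of projective points at `s`.
  obtain ⟨s, hs⟩ := exists_eval_ne_zero
    (MvPolynomial.aeval (fun k => P k.1 k.2) f₁ * MvPolynomial.aeval (fun k => P k.1 k.2) f₂ *
      (∏ i, P i (k i)) * g) (by
    refine mul_ne_zero (mul_ne_zero (mul_ne_zero ?_ ?_)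
      (Finset.prod_ne_zero_iff.2 fun i _ => hk i)) hg
    · intro h
      simp [h] at hp₁
    · intro h
      simp [h] at hp₂)
  simp only [Polynomial.eval_mul, ne_eq, mul_eq_zero, not_or, Polynomial.eval_prod,
    Finset.prod_eq_zero_iff, not_exists, Finset.mem_univ, true_and] at hs
  obtain ⟨⟨⟨ha, hb⟩, hc⟩, hd⟩ := hs
  have h : ∀ i, curveAt P s i ≠ 0 := fun i hi => hc i (congrFun hi (k i))
  refine ⟨s, h, ⟨hs₁ ?_, hs₂ ?_⟩, hd⟩
  · rwa [mkTuple_mem_nonvanishingLocus hf₁, ← eval_aeval_curve]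
  · rwa [mkTuple_mem_nonvanishingLocus hf₂, ← eval_aeval_curve]

/-- A subset of an open set `O` in which any two points are joined by a polynomial curve whose
points in `O` stay in the subset is irreducible. -/
lemma isPreirreducible_of_curves [Infinite 𝕜] {Z O : Set (ProjPow 𝕜 n y)} (hO : IsOpen O)
    (hZO : Z ⊆ O)
    (h : ∀ z₁ ∈ Z, ∀ z₂ ∈ Z, ∃ (P : Fin y → Fin (n + 1) → Polynomial 𝕜) (s₁ s₂ : 𝕜)
      (h₁ : ∀ i, curveAt P s₁ i ≠ 0) (h₂ : ∀ i, curveAt P s₂ i ≠ 0),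
      mkTuple _ h₁ = z₁ ∧ mkTuple _ h₂ = z₂ ∧
      ∀ (s : 𝕜) (hs : ∀ i, curveAt P s i ≠ 0), mkTuple _ hs ∈ O → mkTuple _ hs ∈ Z) :
    IsPreirreducible Z := by
  rintro U V hU hV ⟨z₁, hz₁, hzU⟩ ⟨z₂, hz₂, hzV⟩
  obtain ⟨P, s₁, s₂, h₁, h₂, rfl, rfl, hP⟩ := h z₁ hz₁ z₂ hz₂
  -- Intersecting `U` with `O` puts the common point in `O`, hence back in `Z`.
  obtain ⟨s, hs, hm, -⟩ := exists_curveAt_mem P h₁ h₂ (hU.inter hO) hV ⟨hzU, hZO hz₁⟩ hzV 1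
    one_ne_zero
  exact ⟨_, hP s hs hm.1.2, hm.1.1, hm.2⟩

lemma isPreirreducible_univ_projPow [Infinite 𝕜] :
    IsPreirreducible (Set.univ : Set (ProjPow 𝕜 n y)) := by
  refine isPreirreducible_of_curves isOpen_univ subset_rfl fun z₁ _ z₂ _ => ?_
  let P : Fin y → Fin (n + 1) → Polynomial 𝕜 := fun i k => Polynomial.C ((z₁ i).rep k) +
    Polynomial.X * Polynomial.C ((z₂ i).rep k - (z₁ i).rep k)
  have e₁ : curveAt P 0 = fun i => (z₁ i).rep := by
    funext i k
    simp [curveAt, P]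
  have e₂ : curveAt P 1 = fun i => (z₂ i).rep := by
    funext i k
    simp [curveAt, P]
  refine ⟨P, 0, 1, fun i => ?_, fun i => ?_, ?_, ?_, fun _ _ _ => trivial⟩
  · rw [e₁]; exact (z₁ i).rep_nonzero
  · rw [e₂]; exact (z₂ i).rep_nonzero
  · exact mkTuple_eq_of_rep _ e₁
  · exact mkTuple_eq_of_rep _ e₂

lemma isMultihomogeneous_rename {y' : ℕ} (σ : Fin y → Fin y')
    {f : MvPolynomial (Fin y × Fin (n + 1)) 𝕜} {e : Fin y → ℕ} (hf : IsMultihomogeneous f e) :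
    IsMultihomogeneous (MvPolynomial.rename (Prod.map σ id) f)
      (fun i => ∑ j, if σ j = i then e j else 0) := by
  intro d hd
  obtain ⟨u, rfl, hu⟩ := MvPolynomial.coeff_rename_ne_zero _ _ _ hd
  have hw := hf hu
  rw [← hw, Finsupp.weight_apply, Finsupp.sum_mapDomain_index (by simp) (by simp [add_smul])]
  funext i
  simp_rw [weight_single_apply]
  rw [Finsupp.sum_fintype _ _ (by simp), Finset.sum_apply, Fintype.sum_prod_type]
  refine Finset.sum_congr rfl fun j _ => ?_
  split_ifs with h
  · simp [h]
  · simp [Ne.symm h]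

/-- The map of products of projective spaces given by a map of the index sets. -/
def reindex {y' : ℕ} (σ : Fin y → Fin y') (p : ProjPow 𝕜 n y') : ProjPow 𝕜 n y :=
  fun i => p (σ i)

lemma continuous_reindex {y' : ℕ} (σ : Fin y → Fin y') :
    Continuous (reindex σ : ProjPow 𝕜 n y' → ProjPow 𝕜 n y) := by
  refine continuous_generateFrom_iff.2 ?_
  rintro _ ⟨f, e, hf, rfl⟩
  convert isOpen_nonvanishingLocus (isMultihomogeneous_rename σ hf) using 1
  ext p
  simp [nonvanishingLocus, reindex, MvPolynomial.eval_rename, Function.comp_def, Prod.map]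

end ZariskiTopology

/-! ### The quotient map from ordered tuples to point sets. -/

section ForgetOrder

variable {𝕜 : Type*} [Field 𝕜] {n x : ℕ}

lemma continuous_forgetOrder :
    Continuous (forgetOrder : DistinctTuples 𝕜 n x → PointSets 𝕜 n x) :=
  continuous_coinduced_rng

lemma forgetOrder_val (p : DistinctTuples 𝕜 n x) :
    ((forgetOrder p).1 : Set (PSpace 𝕜 n)) = Set.range (p.1 : Fin x → PSpace 𝕜 n) := by
  simp only [forgetOrder, Finset.coe_map, Finset.coe_univ, Set.image_univ]
  rfl

lemma mem_forgetOrder (p : DistinctTuples 𝕜 n x) (q : PSpace 𝕜 n) :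
    q ∈ (forgetOrder p).1 ↔ ∃ i, p.1 i = q := by
  rw [← Finset.mem_coe, forgetOrder_val]
  rfl

lemma exists_perm_of_forgetOrder_eq {p q : DistinctTuples 𝕜 n x}
    (h : forgetOrder p = forgetOrder q) :
    ∃ σ : Equiv.Perm (Fin x), q.1 = reindex σ p.1 := by
  have h1 : ∀ i, ∃ j, p.1 j = q.1 i := fun i => by
    rw [← mem_forgetOrder, h, mem_forgetOrder]
    exact ⟨i, rfl⟩
  choose σ hσ using h1
  have hinj : Function.Injective σ := fun i j hij => q.2 (by rw [← hσ, ← hσ, hij])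
  refine ⟨Equiv.ofBijective σ (Finite.injective_iff_bijective.1 hinj), ?_⟩
  funext i
  exact (hσ i).symm

/-- Permutation of the points of a tuple of distinct points. -/
def permute (σ : Equiv.Perm (Fin x)) (p : DistinctTuples 𝕜 n x) : DistinctTuples 𝕜 n x :=
  ⟨reindex σ p.1, p.2.comp σ.injective⟩

lemma continuous_permute (σ : Equiv.Perm (Fin x)) :
    Continuous (permute σ : DistinctTuples 𝕜 n x → DistinctTuples 𝕜 n x) :=
  ((continuous_reindex σ).comp continuous_subtype_val).subtype_mk _

lemma forgetOrder_permute (σ : Equiv.Perm (Fin x)) (p : DistinctTuples 𝕜 n x) :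
    forgetOrder (permute σ p) = forgetOrder p := by
  apply Subtype.ext
  ext q
  rw [mem_forgetOrder, mem_forgetOrder]
  exact σ.exists_congr_left.trans (by simp [permute, reindex])

/-- The saturation of a closed set is the union of its translates under the finite symmetric group.
-/
lemma isClosedMap_forgetOrder :
    IsClosedMap (forgetOrder : DistinctTuples 𝕜 n x → PointSets 𝕜 n x) := by
  intro W hW
  rw [← isOpen_compl_iff, isOpen_coinduced, Set.preimage_compl, isOpen_compl_iff]
  have : forgetOrder ⁻¹' (forgetOrder '' W) =
      ⋃ σ : Equiv.Perm (Fin x), (permute σ : DistinctTuples 𝕜 n x → _) ⁻¹' W := by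
    ext p
    simp only [Set.mem_preimage, Set.mem_image, Set.mem_iUnion]
    constructor
    · rintro ⟨q, hq, hqp⟩
      obtain ⟨σ, hσ⟩ := exists_perm_of_forgetOrder_eq hqp.symm
      refine ⟨σ, ?_⟩
      have : permute σ p = q := Subtype.ext hσ.symm
      rwa [this]
    · rintro ⟨σ, hσ⟩
      exact ⟨_, hσ, forgetOrder_permute σ p⟩
  rw [this]
  exact isClosed_iUnion_of_finite fun σ => hW.preimage (continuous_permute σ)

/-- This moves a collinear subset into the first positions of an ordering. -/
lemma exists_forgetOrder_eq_of_subset (S : PointSets 𝕜 n x) {A : Finset (PSpace 𝕜 n)}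
    (hA : A ⊆ S.1) : ∃ p : DistinctTuples 𝕜 n x, forgetOrder p = S ∧
      ∀ i : Fin x, i.1 < A.card → p.1 i ∈ A := by
  classical
  have hx : A.card + (S.1 \ A).card = x := by
    rw [add_comm, Finset.card_sdiff_add_card_eq_card hA, S.2]
  let e : Fin x → PSpace 𝕜 n := fun i =>
    Fin.append (fun j => (A.equivFin.symm j : PSpace 𝕜 n))
      (fun j => ((S.1 \ A).equivFin.symm j : PSpace 𝕜 n)) (Fin.cast hx.symm i)
  have hS : ∀ i, e i ∈ S.1 := fun i => by
    dsimp only [e]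
    generalize Fin.cast hx.symm i = j
    refine Fin.addCases (fun j => ?_) (fun j => ?_) j
    · simpa using hA (A.equivFin.symm j).2
    · simpa using (Finset.mem_sdiff.1 ((S.1 \ A).equivFin.symm j).2).1
  have hinj : Function.Injective e := by
    refine Function.Injective.comp (Fin.append_injective_iff.2 ⟨?_, ?_, ?_⟩)
      (Fin.cast_injective _)
    · exact Subtype.val_injective.comp (Equiv.injective _)
    · exact Subtype.val_injective.comp (Equiv.injective _)
    · intro i j h
      exact (Finset.mem_sdiff.1 ((S.1 \ A).equivFin.symm j).2).2
        (h ▸ (A.equivFin.symm i).2)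
  refine ⟨⟨e, hinj⟩, ?_, fun i hi => ?_⟩
  · apply Subtype.ext
    refine Finset.eq_of_subset_of_card_le (fun q hq => ?_) ?_
    · obtain ⟨i, rfl⟩ := (mem_forgetOrder _ _).1 hq
      exact hS i
    · rw [(forgetOrder _).2, S.2]
  · change e i ∈ A
    have : Fin.cast hx.symm i = Fin.castAdd _ ⟨i.1, hi⟩ := rfl
    dsimp only [e]
    rw [this, Fin.append_left]
    exact (A.equivFin.symm _).2

end ForgetOrder

/-! ### Spanning and collinearity in terms of representatives. -/

section Linear

variable {𝕜 : Type*} [Field 𝕜] {n x : ℕ}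

lemma spans_iff (S : Finset (PSpace 𝕜 n)) :
    Spans S ↔ Submodule.span 𝕜 (Projectivization.rep '' (S : Set (PSpace 𝕜 n))) = ⊤ := by
  constructor
  · intro h
    rw [← map_eq_top_iff (f := (Submodule.projectivization (K := 𝕜) (V := Fin (n + 1) → 𝕜))),
      ← top_le_iff]
    rw [Spans] at h
    rw [← h, Projectivization.Subspace.span_le_subspace_iff]
    intro p hp
    have := Submodule.subset_span (R := 𝕜) (Set.mem_image_of_mem Projectivization.rep hp)
    rw [SetLike.mem_coe, ← Submodule.mk_mem_projectivization_iff _ p.rep_nonzero,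
      Projectivization.mk_rep] at this
    exact this
  · intro h
    rw [Spans, ← map_eq_top_iff
      (f := (Projectivization.Subspace.submodule (K := 𝕜) (V := Fin (n + 1) → 𝕜))),
      ← top_le_iff, ← h, Submodule.span_le]
    rintro _ ⟨p, hp, rfl⟩
    rw [SetLike.mem_coe, Projectivization.Subspace.mem_submodule_iff _ p.rep_nonzero,
      Projectivization.mk_rep]
    exact Projectivization.Subspace.subset_span _ hp

lemma isCollinear_iff_exists_submodule (A : Set (PSpace 𝕜 n)) :
    Projectivization.IsCollinear A ↔ ∃ N : Submodule 𝕜 (Fin (n + 1) → 𝕜),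
      Module.finrank 𝕜 N ≤ 2 ∧ ∀ p ∈ A, p.rep ∈ N := by
  constructor
  · rintro ⟨M, -, hM, hA⟩
    refine ⟨M.submodule, hM, fun p hp => ?_⟩
    rw [Projectivization.Subspace.mem_submodule_iff _ p.rep_nonzero, Projectivization.mk_rep]
    exact hA hp
  · rintro ⟨N, hN, hA⟩
    refine ⟨N.projectivization, ?_, ?_, fun p hp => ?_⟩
    · rw [Projectivization.Subspace.submodule.apply_symm_apply]
      infer_instance
    · rwa [Projectivization.Subspace.submodule.apply_symm_apply]
    · have := hA p hp
      rwa [← Submodule.mk_mem_projectivization_iff _ p.rep_nonzero,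
        Projectivization.mk_rep] at this

lemma not_linearIndependent_of_isCollinear {A : Set (PSpace 𝕜 n)}
    (hA : Projectivization.IsCollinear A) {v : Fin 3 → PSpace 𝕜 n} (hv : ∀ i, v i ∈ A) :
    ¬ LinearIndependent 𝕜 fun i => (v i).rep := by
  obtain ⟨N, hN, hA⟩ := (isCollinear_iff_exists_submodule A).1 hA
  intro h
  have h1 : LinearIndependent 𝕜 fun i => (⟨(v i).rep, hA _ (hv i)⟩ : N) :=
    LinearIndependent.of_comp N.subtype h
  have := h1.fintype_card_le_finrank
  simp at this
  omega

lemma mem_span_pair_of_not_linearIndependent {V : Type*} [AddCommGroup V] [Module 𝕜 V]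
    {u v w : V} (h : LinearIndependent 𝕜 ![u, v]) (h' : ¬ LinearIndependent 𝕜 ![u, v, w]) :
    ∃ a b : 𝕜, w = a • u + b • v := by
  by_contra hw
  apply h'
  have : (![u, v, w] : Fin 3 → V) = Fin.snoc (α := fun _ => V) ![u, v] w := by
    funext i
    fin_cases i <;> rfl
  rw [this, linearIndependent_finSnoc]
  refine ⟨h, fun hm => hw ?_⟩
  rw [Matrix.range_cons_cons_empty, Submodule.mem_span_pair] at hm
  obtain ⟨a, b, hab⟩ := hm
  exact ⟨a, b, hab.symm⟩

/-- A spanning family of vectors contains a basis, which has n + 1 elements; this makes spanning a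
union of open conditions. -/
lemma spans_forgetOrder_iff (p : DistinctTuples 𝕜 n x) :
    Spans (forgetOrder p).1 ↔ ∃ e : Fin (n + 1) → Fin x, p.1 ∈ independentLocus 𝕜 n e := by
  have hr : Projectivization.rep '' Set.range (p.1 : Fin x → PSpace 𝕜 n) =
      Set.range fun i => (p.1 i).rep := (Set.range_comp _ _).symm
  rw [spans_iff, forgetOrder_val, hr]
  constructor
  · intro h
    obtain ⟨f, hf, -, hl⟩ := Submodule.exists_fun_fin_finrank_span_eq 𝕜
      (Set.range fun i => (p.1 i).rep)
    have hfr : Module.finrank 𝕜 (Submodule.span 𝕜 (Set.range fun i => (p.1 i).rep)) = n + 1 := by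
      rw [h, finrank_top]
      simp
    choose e he using hf
    refine ⟨e ∘ Fin.cast hfr.symm, ?_⟩
    have : (fun i => (p.1 ((e ∘ Fin.cast hfr.symm) i)).rep) = f ∘ Fin.cast hfr.symm := by
      funext i
      exact he _
    change LinearIndependent 𝕜 _
    rw [this]
    exact hl.comp _ (Fin.cast_injective _)
  · rintro ⟨e, he⟩
    have := LinearIndependent.span_eq_top_of_card_eq_finrank' he (by simp)
    rw [← top_le_iff, ← this]
    refine Submodule.span_mono ?_
    rintro _ ⟨i, rfl⟩
    exact ⟨e i, rfl⟩

lemma isOpen_spans : IsOpen {S : PointSets 𝕜 n x | Spans S.1} := by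
  rw [isOpen_coinduced]
  have : forgetOrder ⁻¹' {S : PointSets 𝕜 n x | Spans S.1} =
      ⋃ e : Fin (n + 1) → Fin x, Subtype.val ⁻¹' independentLocus 𝕜 n e := by
    ext p
    simp [spans_forgetOrder_iff]
  rw [this]
  exact isOpen_iUnion fun e => (isOpen_independentLocus e).preimage continuous_subtype_val

end Linear

/-! ### Bounds for topological Krull dimension. -/

section KrullDimension

open TopologicalSpace Topology

/-- `W` has finitely many irreducible components; their images are closed and cover the irreducible
set `C`, so one image is all of `C`. -/
lemma exists_irreducible_lift {X Y : Type*} [TopologicalSpace X] [TopologicalSpace Y]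
    [NoetherianSpace X] {f : X → Y} (hc : IsClosedMap f)
    {W : Set X} (hW : IsClosed W) {C : Set Y} (hC : IsIrreducible C) (hWC : f '' W = C) :
    ∃ D : Set X, D ⊆ W ∧ IsClosed D ∧ IsIrreducible D ∧ f '' D = C := by
  obtain ⟨S, hfin, hcl, hirr, rfl⟩ := NoetherianSpace.exists_finite_set_isClosed_irreducible hW
  have hcov : C ⊆ ⋃₀ ((fun D => f '' D) '' S) := by
    rw [← hWC, Set.image_sUnion]
  lift S to Finset (Set X) using hfin
  classical
  obtain ⟨Z, hZ, hCZ⟩ := (isIrreducible_iff_sUnion_isClosed.1 hC) (S.image fun D => f '' D)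
    (by
      intro Z hZ
      obtain ⟨D, hD, rfl⟩ := Finset.mem_image.1 hZ
      exact hc _ (hcl D hD))
    (by simpa using hcov)
  obtain ⟨D, hD, rfl⟩ := Finset.mem_image.1 hZ
  refine ⟨D, Set.subset_sUnion_of_mem hD, hcl D hD, hirr D hD, Set.Subset.antisymm ?_ hCZ⟩
  rw [← hWC]
  exact Set.image_mono (Set.subset_sUnion_of_mem hD)

/-- A closed continuous surjection from a Noetherian space does not raise the bound on the Krull
dimension given by a strictly monotone rank function. -/
lemma topologicalKrullDim_le_of_isClosedMap {X Y : Type*} [TopologicalSpace X]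
    [TopologicalSpace Y] [NoetherianSpace X] {f : X → Y} (hf : Continuous f)
    (hc : IsClosedMap f) (hs : Function.Surjective f) {N : ℕ} (r : IrreducibleCloseds X → ℕ)
    (hr : StrictMono r) (hN : ∀ C, r C ≤ N) : topologicalKrullDim Y ≤ N := by
  have hex : ∀ C : IrreducibleCloseds Y, ∃ D : IrreducibleCloseds X,
      f '' (D : Set X) = C ∧ ∀ D' : IrreducibleCloseds X, f '' (D' : Set X) = C → r D ≤ r D' := by
    intro C
    have hne : {D : IrreducibleCloseds X | f '' (D : Set X) = C}.Nonempty := by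
      obtain ⟨D, -, h1, h2, h3⟩ := exists_irreducible_lift hc (C.isClosed.preimage hf)
        C.isIrreducible (Set.image_preimage_eq _ hs)
      exact ⟨⟨D, h2, h1⟩, h3⟩
    -- The lift is chosen of minimal rank: chosen lifts of nested sets need not be nested, and
    -- minimality replaces nesting in the comparison below.
    obtain ⟨D, hD, hmin⟩ := (measure r).wf.has_min _ hne
    exact ⟨D, hD, fun D' hD' => not_lt.1 (hmin D' hD')⟩
  choose D hD hmin using hex
  have hmono : StrictMono fun C => r (D C) := by
    intro C C' hlt
    -- A lift of `C` found inside the lift of `C'` is a proper subset of it, since the images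
    -- differ. Its rank bounds that of the chosen lift of `C`.
    obtain ⟨E, hE, h1, h2, h3⟩ := exists_irreducible_lift hc
      ((D C').isClosed.inter (C.isClosed.preimage hf)) C.isIrreducible (by
        rw [Set.image_inter_preimage, hD]
        exact Set.inter_eq_right.2 hlt.le)
    let E' : IrreducibleCloseds X := ⟨E, h2, h1⟩
    refine (hmin C E' h3).trans_lt (hr (lt_of_le_of_ne (fun z hz => (hE hz).1) ?_))
    intro he
    apply hlt.ne
    apply SetLike.coe_injective
    rw [← h3, ← hD C', ← he]
    rfl
  refine iSup_le fun p => ?_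
  have h := (p.map _ hmono).head_add_length_le_nat
  have h2 := hN (D p.last)
  have h3 : (p.map _ hmono).last = r (D p.last) := rfl
  have h4 : (p.map _ hmono).length = p.length := rfl
  have : p.length ≤ N := by omega
  exact_mod_cast this

/-- The closures of the `E j` form the chain. The sets `F` show that consecutive closures differ, so
no closure has to be computed. -/
lemma le_topologicalKrullDim_of_chain {T : Type*} [TopologicalSpace T] {N : ℕ}
    (E : ℕ → Set T) (hE : ∀ j ≤ N, IsIrreducible (E j)) (hmono : ∀ j < N, E (j + 1) ⊆ E j)
    (hF : ∀ j < N, ∃ F : Set T, IsClosed F ∧ E (j + 1) ⊆ F ∧ ¬ E j ⊆ F) :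
    (N : WithBot ℕ∞) ≤ topologicalKrullDim T := by
  let Z : Fin (N + 1) → IrreducibleCloseds T := fun i =>
    ⟨closure (E (N - i)), (hE _ (Nat.sub_le _ _)).closure, isClosed_closure⟩
  have hZ : StrictMono Z := by
    rw [Fin.strictMono_iff_lt_succ]
    intro i
    have hi : N - i.1 = N - (i.1 + 1) + 1 := by omega
    have hlt : N - (i.1 + 1) < N := by omega
    refine lt_of_le_of_ne ?_ ?_
    · change closure (E (N - i.1)) ⊆ closure (E (N - (i.1 + 1)))
      rw [hi]
      exact closure_mono (hmono _ hlt)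
    · intro h
      have h' : closure (E (N - i.1)) = closure (E (N - (i.1 + 1))) :=
        congrArg (fun W : IrreducibleCloseds T => (W : Set T)) h
      rw [hi] at h'
      obtain ⟨F, hF, hEF, hnot⟩ := hF _ hlt
      refine hnot (subset_closure.trans ?_)
      rw [← h']
      exact closure_minimal hEF hF
  exact Order.le_krullDim_iff.2 ⟨LTSeries.mk N Z hZ, rfl⟩

lemma isIrreducible_preimage_val {T : Type*} [TopologicalSpace T] {K E : Set T}
    (hE : IsIrreducible E) (hEK : E ⊆ K) : IsIrreducible (Subtype.val ⁻¹' E : Set K) := by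
  refine ⟨?_, ?_⟩
  · obtain ⟨t, ht⟩ := hE.1
    exact ⟨⟨t, hEK ht⟩, ht⟩
  · rintro _ _ ⟨U, hU, rfl⟩ ⟨V, hV, rfl⟩ ⟨u, hu, huU⟩ ⟨v, hv, hvV⟩
    obtain ⟨t, ht, htUV⟩ := hE.2 U V hU hV ⟨u, hu, huU⟩ ⟨v, hv, hvV⟩
    exact ⟨⟨t, hEK ht⟩, ht, htUV⟩

end KrullDimension

/-! ### Krull dimension of quotients and of finitely generated domains. -/

section RingDimension

variable {𝕜 : Type*} [Field 𝕜]

/-- An element of `Q` outside `P` is a nonzerodivisor on `R ⧸ P`. Dividing by it lowers the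
dimension by at least one, and `R ⧸ Q` is a further quotient. -/
lemma ringKrullDim_quotient_lt {R : Type*} [CommRing R] {P Q : Ideal R} [P.IsPrime]
    (h : P < Q) : ringKrullDim (R ⧸ Q) + 1 ≤ ringKrullDim (R ⧸ P) := by
  obtain ⟨hle, f, hfQ, hfP⟩ := SetLike.lt_iff_le_and_exists.1 h
  have hf : Ideal.Quotient.mk P f ∈ nonZeroDivisors (R ⧸ P) :=
    mem_nonZeroDivisors_of_ne_zero fun h0 => hfP (Ideal.Quotient.eq_zero_iff_mem.1 h0)
  refine le_trans ?_ (ringKrullDim_quotient_succ_le_of_nonZeroDivisor hf)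
  gcongr
  refine ringKrullDim_le_of_surjective
    (Ideal.Quotient.lift (Ideal.span {Ideal.Quotient.mk P f}) (Ideal.Quotient.factor hle) ?_) ?_
  · intro a ha
    obtain ⟨b, rfl⟩ := Ideal.mem_span_singleton'.1 ha
    rw [map_mul, Ideal.Quotient.factor_mk, Ideal.Quotient.eq_zero_iff_mem.2 hfQ, mul_zero]
  · exact Ideal.Quotient.lift_surjective_of_surjective _ _
      (Ideal.Quotient.factor_surjective hle)

/-- Incomparability: strictly nested primes of an integral extension contract to strictly nested
primes. -/
lemma ringKrullDim_le_of_isIntegral {A B : Type*} [CommRing A] [CommRing B] [Algebra A B]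
    [Algebra.IsIntegral A B] : ringKrullDim B ≤ ringKrullDim A := by
  refine Order.krullDim_le_of_strictMono (PrimeSpectrum.comap (algebraMap A B)) ?_
  intro P Q h
  exact Ideal.IsIntegral.comap_lt_comap (R := A) h

/-- A finitely generated subalgebra of a polynomial ring in `N` variables over a field has
dimension at most `N`. -/
lemma ringKrullDim_quotient_ker_le {ι τ : Type*} [Finite ι] [Fintype τ]
    (φ : MvPolynomial ι 𝕜 →ₐ[𝕜] MvPolynomial τ 𝕜) :
    ringKrullDim (MvPolynomial ι 𝕜 ⧸ RingHom.ker φ) ≤ Fintype.card τ := by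
  have hp : (RingHom.ker φ).IsPrime := RingHom.ker_isPrime φ
  have : Nontrivial (MvPolynomial ι 𝕜 ⧸ RingHom.ker φ) := Ideal.Quotient.nontrivial_iff.2 hp.ne_top
  -- Noether normalization bounds the dimension by `s`. The `s` variables stay algebraically
  -- independent in the polynomial ring over `τ`, so transcendence degree gives `s ≤ |τ|`.
  obtain ⟨s, g, hg, hi⟩ := exists_integral_inj_algHom_of_fg 𝕜 (MvPolynomial ι 𝕜 ⧸ RingHom.ker φ)
  have h1 : ringKrullDim (MvPolynomial ι 𝕜 ⧸ RingHom.ker φ) ≤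
      ringKrullDim (MvPolynomial (Fin s) 𝕜) := by
    algebraize [g.toRingHom]
    have : Algebra.IsIntegral (MvPolynomial (Fin s) 𝕜) (MvPolynomial ι 𝕜 ⧸ RingHom.ker φ) :=
      ⟨hi⟩
    exact ringKrullDim_le_of_isIntegral
  refine h1.trans ?_
  rw [MvPolynomial.ringKrullDim_of_isNoetherianRing, ringKrullDim_eq_zero_of_field, zero_add]
  have h2 : Function.Injective ((Ideal.kerLiftAlg φ).comp g) :=
    (Ideal.kerLiftAlg_injective φ).comp hg
  have h3 := lift_trdeg_le_of_injective _ h2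
  rw [MvPolynomial.trdeg_of_isDomain, MvPolynomial.trdeg_of_isDomain] at h3
  have h4 : s ≤ Fintype.card τ := by simpa using h3
  simpa using h4

end RingDimension

/-! ### Multigraded cones and their coordinate rings. -/

section Cone

variable {𝕜 : Type*} [Field 𝕜] {n y : ℕ}

/-- Evaluation of a polynomial at the points `(λᵢ pᵢ)ᵢ` of the cone over `p`, as a polynomial
in `λ`. -/
def coneHom (p : ProjPow 𝕜 n y) :
    MvPolynomial (Fin y × Fin (n + 1)) 𝕜 →ₐ[𝕜] MvPolynomial (Fin y) 𝕜 :=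
  MvPolynomial.aeval fun k => MvPolynomial.X k.1 * MvPolynomial.C ((p k.1).rep k.2)

/-- The polynomials that vanish on the cone over `Y`. -/
def coneIdeal (Y : Set (ProjPow 𝕜 n y)) : Ideal (MvPolynomial (Fin y × Fin (n + 1)) 𝕜) :=
  ⨅ p ∈ Y, RingHom.ker (coneHom p)

lemma mem_coneIdeal {Y : Set (ProjPow 𝕜 n y)} {f : MvPolynomial (Fin y × Fin (n + 1)) 𝕜} :
    f ∈ coneIdeal Y ↔ ∀ p ∈ Y, coneHom p f = 0 := by
  simp [coneIdeal, Submodule.mem_iInf, RingHom.mem_ker]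

lemma coneHom_of_isMultihomogeneous {f : MvPolynomial (Fin y × Fin (n + 1)) 𝕜} {e : Fin y → ℕ}
    (hf : IsMultihomogeneous f e) (p : ProjPow 𝕜 n y) :
    coneHom p f = MvPolynomial.monomial (Finsupp.equivFunOnFinite.symm e)
      (MvPolynomial.eval (fun k => (p k.1).rep k.2) f) := by
  rw [coneHom, hf.eval₂_smul]
  have : MvPolynomial.aeval (fun k : Fin y × Fin (n + 1) =>
      (MvPolynomial.C ((p k.1).rep k.2) : MvPolynomial (Fin y) 𝕜)) f =
      MvPolynomial.C (MvPolynomial.eval (fun k => (p k.1).rep k.2) f) :=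
    MvPolynomial.aeval_algebraMap_apply _ (fun k : Fin y × Fin (n + 1) => (p k.1).rep k.2) f
  rw [this, MvPolynomial.monomial_eq, mul_comm, Finsupp.prod_fintype _ _ (by simp)]
  rfl

lemma coneHom_eq_zero_iff_of_isMultihomogeneous {f : MvPolynomial (Fin y × Fin (n + 1)) 𝕜}
    {e : Fin y → ℕ} (hf : IsMultihomogeneous f e) (p : ProjPow 𝕜 n y) :
    coneHom p f = 0 ↔ p ∉ nonvanishingLocus f := by
  rw [coneHom_of_isMultihomogeneous hf, MvPolynomial.monomial_eq_zero, nonvanishingLocus]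
  simp

/-- Components of different multidegree go to multiples of different monomials in `λ`, so they
cannot cancel. -/
lemma coneHom_ne_zero_iff (f : MvPolynomial (Fin y × Fin (n + 1)) 𝕜) (p : ProjPow 𝕜 n y) :
    coneHom p f ≠ 0 ↔ ∃ e : Fin y → ℕ, p ∈ nonvanishingLocus
      (MvPolynomial.weightedHomogeneousComponent
        (fun k => (Pi.single k.1 1 : Fin y → ℕ)) e f) := by
  classical
  set w : Fin y × Fin (n + 1) → Fin y → ℕ := fun k => Pi.single k.1 1
  have hw : ∀ e, IsMultihomogeneous (MvPolynomial.weightedHomogeneousComponent w e f) e :=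
    fun e => MvPolynomial.weightedHomogeneousComponent_isWeightedHomogeneous e f
  have hfin := MvPolynomial.weightedHomogeneousComponent_finsupp (w := w) f
  have hsum : coneHom p f = ∑ e ∈ hfin.toFinset,
      MvPolynomial.monomial (Finsupp.equivFunOnFinite.symm e) (MvPolynomial.eval
        (fun k => (p k.1).rep k.2) (MvPolynomial.weightedHomogeneousComponent w e f)) := by
    conv_lhs => rw [← MvPolynomial.sum_weightedHomogeneousComponent w f, finsum_eq_sum _ hfin]
    rw [map_sum]
    exact Finset.sum_congr rfl fun e _ => coneHom_of_isMultihomogeneous (hw e) p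
  constructor
  · intro h
    by_contra! h'
    apply h
    rw [hsum]
    refine Finset.sum_eq_zero fun e _ => ?_
    have := h' e
    simp only [nonvanishingLocus, Set.mem_ofPred_eq, not_not] at this
    rw [this, map_zero]
  · rintro ⟨e, he⟩ h0
    have hc := congrArg (MvPolynomial.coeff (Finsupp.equivFunOnFinite.symm e)) h0
    rw [hsum, MvPolynomial.coeff_sum] at hc
    simp only [MvPolynomial.coeff_monomial, EmbeddingLike.apply_eq_iff_eq,
      Finset.sum_ite_eq', MvPolynomial.coeff_zero] at hc
    apply he
    split_ifs at hc with h
    · exact hc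
    · have : MvPolynomial.weightedHomogeneousComponent w e f = 0 :=
        by_contra fun hne => h (hfin.mem_toFinset.2 hne)
      rw [this, map_zero]

/-- If `f` and `g` are outside the ideal, each has a component not vanishing somewhere on `Y`. By
irreducibility both are nonzero at a common point `z`, and `coneHom z` takes values in a domain. -/
lemma isPrime_coneIdeal {Y : Set (ProjPow 𝕜 n y)} (hY : IsIrreducible Y) :
    (coneIdeal Y).IsPrime := by
  obtain ⟨p₀, hp₀⟩ := hY.1
  refine ⟨fun h => ?_, fun {f g} hfg => ?_⟩
  · have := mem_coneIdeal.1 ((Ideal.eq_top_iff_one _).1 h) p₀ hp₀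
    simp at this
  · by_contra! h
    simp only [mem_coneIdeal, not_forall] at h
    obtain ⟨⟨p, hp, hpf⟩, q, hq, hqg⟩ := h
    obtain ⟨e, he⟩ := (coneHom_ne_zero_iff f p).1 hpf
    obtain ⟨e', he'⟩ := (coneHom_ne_zero_iff g q).1 hqg
    obtain ⟨z, hz, hz₁, hz₂⟩ := hY.2 _ _
      (isOpen_nonvanishingLocus
        (MvPolynomial.weightedHomogeneousComponent_isWeightedHomogeneous e f))
      (isOpen_nonvanishingLocus
        (MvPolynomial.weightedHomogeneousComponent_isWeightedHomogeneous e' g))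
      ⟨p, hp, he⟩ ⟨q, hq, he'⟩
    have := mem_coneIdeal.1 hfg z hz
    rw [map_mul] at this
    exact mul_ne_zero ((coneHom_ne_zero_iff f z).2 ⟨e, hz₁⟩)
      ((coneHom_ne_zero_iff g z).2 ⟨e', hz₂⟩) this

lemma coneIdeal_lt {Y Y' W : Set (ProjPow 𝕜 n y)} (h : Y ⊆ Y') (hW : IsClosed W) (hYW : Y ⊆ W)
    {p : ProjPow 𝕜 n y} (hp : p ∈ Y') (hpW : p ∉ W) : coneIdeal Y' < coneIdeal Y := by
  obtain ⟨f, e, hf, hpf, hfW⟩ := exists_nonvanishingLocus_subset hW.isOpen_compl hpW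
  refine SetLike.lt_iff_le_and_exists.2 ⟨fun g hg => mem_coneIdeal.2 fun q hq =>
    mem_coneIdeal.1 hg q (h hq), f, mem_coneIdeal.2 fun q hq => ?_, fun hfY => ?_⟩
  · rw [coneHom_eq_zero_iff_of_isMultihomogeneous hf]
    exact fun hqf => hfW hqf (hYW hq)
  · exact (coneHom_eq_zero_iff_of_isMultihomogeneous hf p).1 (mem_coneIdeal.1 hfY p hp) hpf

/-- `coneIdeal` strictly reverses inclusions of closed sets, so Hilbert's basis theorem gives the
descending chain condition. -/
instance : TopologicalSpace.NoetherianSpace (ProjPow 𝕜 n y) := by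
  refine ((TopologicalSpace.noetherianSpace_TFAE _).out 0 1).2 ?_
  refine StrictAnti.wellFoundedLT
    (f := fun C : TopologicalSpace.Closeds (ProjPow 𝕜 n y) =>
      coneIdeal (C : Set (ProjPow 𝕜 n y))) ?_
  intro C C' h
  obtain ⟨hle, p, hp, hp'⟩ := SetLike.lt_iff_le_and_exists.1 h
  exact coneIdeal_lt hle C.isClosed subset_rfl hp hp'

lemma surjective_coneHom (p : ProjPow 𝕜 n y) : Function.Surjective (coneHom p) := by
  rw [← AlgHom.range_eq_top, ← top_le_iff, ← MvPolynomial.adjoin_range_X, Algebra.adjoin_le_iff]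
  rintro _ ⟨i, rfl⟩
  obtain ⟨k, hk⟩ := Function.ne_iff.1 (p i).rep_nonzero
  refine ⟨MvPolynomial.C ((p i).rep k)⁻¹ * MvPolynomial.X (i, k), ?_⟩
  change coneHom p _ = _
  rw [coneHom, map_mul, MvPolynomial.aeval_X, MvPolynomial.aeval_C, MvPolynomial.algebraMap_eq,
    mul_left_comm, ← map_mul, inv_mul_cancel₀ hk, map_one, mul_one]

/-- Restriction to the cone over a single point has the polynomial ring in `y` variables as its
image. -/
lemma le_ringKrullDim_quotient_coneIdeal {Y : Set (ProjPow 𝕜 n y)} (hY : Y.Nonempty) :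
    (y : WithBot ℕ∞) ≤ ringKrullDim (MvPolynomial (Fin y × Fin (n + 1)) 𝕜 ⧸ coneIdeal Y) := by
  obtain ⟨p, hp⟩ := hY
  have h1 : ringKrullDim (MvPolynomial (Fin y) 𝕜) = y := by
    rw [MvPolynomial.ringKrullDim_of_isNoetherianRing, ringKrullDim_eq_zero_of_field, zero_add]
    simp
  rw [← h1]
  exact ringKrullDim_le_of_surjective
    (Ideal.Quotient.lift (coneIdeal Y) (coneHom p : _ →+* MvPolynomial (Fin y) 𝕜)
      fun f hf => mem_coneIdeal.1 hf p hp)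
    (Ideal.Quotient.lift_surjective_of_surjective _ _ (surjective_coneHom p))

/-- If the cones over the points of `T ⊆ (ℙⁿ)ʸ` lie in the image of an affine space of dimension
`|τ|`, then the irreducible closed subsets of `T` have a strictly monotone rank function bounded
by `|τ| - y`. -/
lemma exists_strictMono_rank {T : Type*} [TopologicalSpace T] {g : T → ProjPow 𝕜 n y}
    (hg : Topology.IsInducing g) {τ : Type*} [Fintype τ]
    (φ : MvPolynomial (Fin y × Fin (n + 1)) 𝕜 →ₐ[𝕜] MvPolynomial τ 𝕜)
    (hφ : ∀ t f, φ f = 0 → coneHom (g t) f = 0) :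
    ∃ r : TopologicalSpace.IrreducibleCloseds T → ℕ, StrictMono r ∧
      ∀ C, r C ≤ Fintype.card τ - y := by
  let I : TopologicalSpace.IrreducibleCloseds T → Ideal (MvPolynomial (Fin y × Fin (n + 1)) 𝕜) :=
    fun C => coneIdeal (g '' C)
  have hup : ∀ C, ringKrullDim (_ ⧸ I C) ≤ Fintype.card τ := fun C => by
    have hle : RingHom.ker φ ≤ I C := fun f hf => mem_coneIdeal.2 (by
      rintro _ ⟨t, -, rfl⟩
      exact hφ t f hf)
    exact (ringKrullDim_le_of_surjective (Ideal.Quotient.factor hle)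
      (Ideal.Quotient.factor_surjective hle)).trans (ringKrullDim_quotient_ker_le φ)
  have hlow : ∀ C, (y : WithBot ℕ∞) ≤ ringKrullDim (_ ⧸ I C) := fun C =>
    le_ringKrullDim_quotient_coneIdeal (C.isIrreducible.1.image g)
  have hex : ∀ C, ∃ r : ℕ, ringKrullDim (_ ⧸ I C) = r := fun C => by
    have h1 := hup C
    have h2 := hlow C
    generalize ringKrullDim (_ ⧸ I C) = a at h1 h2
    induction a with
    | bot => simp at h2
    | coe a =>
      induction a with
      | top => exact absurd h1 (not_le.2 (WithBot.coe_lt_coe.2 (ENat.natCast_lt_top _)))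
      | coe a => exact ⟨a, rfl⟩
  choose r hr using hex
  have h1 : ∀ C, r C ≤ Fintype.card τ := fun C => by
    have := hup C
    rw [hr] at this
    exact_mod_cast this
  have h2 : ∀ C, y ≤ r C := fun C => by
    have := hlow C
    rw [hr] at this
    exact_mod_cast this
  -- Subtracting `y` removes the scalings of the cone. By `h2` the truncated subtraction is exact,
  -- so strictness survives.
  refine ⟨fun C => r C - y, fun C C' h => ?_, fun C => Nat.sub_le_sub_right (h1 C) y⟩
  have hlt : r C < r C' := by
    obtain ⟨hle, t, ht, ht'⟩ := SetLike.lt_iff_le_and_exists.1 h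
    obtain ⟨W, hW, hWC⟩ := hg.isClosed_iff.1 C.isClosed
    have hI : I C' < I C := by
      refine coneIdeal_lt (Set.image_mono hle) hW ?_ (Set.mem_image_of_mem g ht) ?_
      · rw [Set.image_subset_iff, hWC]
      · change t ∉ g ⁻¹' W
        rwa [hWC]
    have : (I C').IsPrime := isPrime_coneIdeal (C'.isIrreducible.image g hg.continuous.continuousOn)
    have := ringKrullDim_quotient_lt hI
    rw [hr, hr] at this
    have h3 : r C + 1 ≤ r C' := by exact_mod_cast this
    omega
  have := h2 C
  dsimp only
  omega

end Cone

/-! ### Ordered tuples with collinear first points, and irreducibility. -/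

section CollinearTuples

variable {𝕜 : Type*} [Field 𝕜] {n x : ℕ}

/-- The tuples whose points with indices `0, …, c` lie on the line through the points `i₀`, `i₁`. -/
def collinearTuples (𝕜 : Type*) [Field 𝕜] (n : ℕ) {x : ℕ} (c : ℕ) (i₀ i₁ : Fin x) :
    Set (ProjPow 𝕜 n x) :=
  {p | ∀ i : Fin x, i.1 ≤ c → p ∉ independentLocus 𝕜 n ![i₀, i₁, i]}

/-- The tuples of distinct points that span `ℙⁿ`. -/
def spanningTuples (𝕜 : Type*) [Field 𝕜] (n x : ℕ) : Set (ProjPow 𝕜 n x) :=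
  {p | Function.Injective (p : Fin x → PSpace 𝕜 n)} ∩
    ⋃ e : Fin (n + 1) → Fin x, independentLocus 𝕜 n e

lemma isOpen_spanningTuples : IsOpen (spanningTuples 𝕜 n x) :=
  isOpen_injective.inter (isOpen_iUnion fun e => isOpen_independentLocus e)

lemma isClosed_collinearTuples (c : ℕ) (i₀ i₁ : Fin x) :
    IsClosed (collinearTuples 𝕜 n c i₀ i₁) := by
  have : collinearTuples 𝕜 n c i₀ i₁ =
      ⋂ (i : Fin x) (_ : i.1 ≤ c), (independentLocus 𝕜 n ![i₀, i₁, i])ᶜ := by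
    ext p
    simp [collinearTuples]
  rw [this]
  exact isClosed_iInter fun i => isClosed_iInter fun _ => (isOpen_independentLocus _).isClosed_compl

lemma mem_independentLocus_triple (i j k : Fin x) (p : ProjPow 𝕜 n x) :
    p ∈ independentLocus 𝕜 n ![i, j, k] ↔
      LinearIndependent 𝕜 ![(p i).rep, (p j).rep, (p k).rep] := by
  change LinearIndependent 𝕜 _ ↔ _
  congr! 1
  funext l
  fin_cases l <;> rfl

lemma exists_rep_eq_of_mem_collinearTuples {c : ℕ} {i₀ i₁ : Fin x} (h₀₁ : i₀ ≠ i₁)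
    {p : ProjPow 𝕜 n x} (hinj : Function.Injective (p : Fin x → PSpace 𝕜 n))
    (hp : p ∈ collinearTuples 𝕜 n c i₀ i₁) (i : Fin x) (hi : i.1 ≤ c) :
    ∃ a b : 𝕜, (p i).rep = a • (p i₀).rep + b • (p i₁).rep := by
  have h := hp i hi
  rw [mem_independentLocus_triple] at h
  exact mem_span_pair_of_not_linearIndependent
    (Projectivization.linearIndependent_pair_iff_ne.2 fun h => h₀₁ (hinj h)) h

lemma finrank_span_pair_le {V : Type*} [AddCommGroup V] [Module 𝕜 V] (u v : V) :
    Module.finrank 𝕜 (Submodule.span 𝕜 {u, v}) ≤ 2 := by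
  classical
  have := finrank_span_finset_le_card (R := 𝕜) ({u, v} : Finset V)
  rw [Finset.coe_pair] at this
  exact this.trans Finset.card_le_two

lemma not_linearIndependent_of_mem_span_pair {V : Type*} [AddCommGroup V] [Module 𝕜 V]
    {u v : V} {w : Fin 3 → V} (hw : ∀ i, ∃ a b : 𝕜, w i = a • u + b • v) :
    ¬ LinearIndependent 𝕜 w := by
  intro h
  have hw' : ∀ i, w i ∈ Submodule.span 𝕜 {u, v} := fun i => by
    obtain ⟨a, b, hab⟩ := hw i
    exact Submodule.mem_span_pair.2 ⟨a, b, hab.symm⟩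
  have h1 : LinearIndependent 𝕜 fun i => (⟨w i, hw' i⟩ : Submodule.span 𝕜 {u, v}) :=
    LinearIndependent.of_comp (Submodule.span 𝕜 {u, v}).subtype h
  have : Module.Finite 𝕜 (Submodule.span 𝕜 {u, v}) :=
    Module.Finite.span_of_finite 𝕜 (Set.toFinite _)
  have h2 := h1.fintype_card_le_finrank
  have h3 := finrank_span_pair_le (𝕜 := 𝕜) u v
  simp at h2
  omega

/-- Linear interpolation. -/
def lerp (r r' : 𝕜) : Polynomial 𝕜 := Polynomial.C r + Polynomial.X * Polynomial.C (r' - r)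

@[simp] lemma eval_lerp (r r' s : 𝕜) : (lerp r r').eval s = r + s * (r' - r) := by simp [lerp]

/-- Both the two base points and the coefficients expressing the other collinear points are
interpolated, so every point of the curve keeps these points in the span of two vectors. -/
lemma isPreirreducible_collinearTuples [Infinite 𝕜] {c : ℕ} {i₀ i₁ : Fin x} (h₀₁ : i₀ ≠ i₁)
    (h₀ : i₀.1 ≤ c) (h₁ : i₁.1 ≤ c) :
    IsPreirreducible (collinearTuples 𝕜 n c i₀ i₁ ∩ spanningTuples 𝕜 n x) := by
  classical
  refine isPreirreducible_of_curves isOpen_spanningTuples Set.inter_subset_right ?_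
  rintro z ⟨hz, hzs⟩ z' ⟨hz', hzs'⟩
  have hex : ∀ i : Fin x, ∃ a b a' b' : 𝕜, i.1 ≤ c →
      ((z i).rep = a • (z i₀).rep + b • (z i₁).rep ∧
        (z' i).rep = a' • (z' i₀).rep + b' • (z' i₁).rep) := fun i => by
    by_cases hi : i.1 ≤ c
    · obtain ⟨a, b, h⟩ := exists_rep_eq_of_mem_collinearTuples h₀₁ hzs.1 hz i hi
      obtain ⟨a', b', h'⟩ := exists_rep_eq_of_mem_collinearTuples h₀₁ hzs'.1 hz' i hi
      exact ⟨a, b, a', b', fun _ => ⟨h, h'⟩⟩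
    · exact ⟨0, 0, 0, 0, fun h => absurd h hi⟩
  choose a b a' b' hab using hex
  let P : Fin x → Fin (n + 1) → Polynomial 𝕜 := fun i k => if i.1 ≤ c then
      lerp (a i) (a' i) * lerp ((z i₀).rep k) ((z' i₀).rep k) +
        lerp (b i) (b' i) * lerp ((z i₁).rep k) ((z' i₁).rep k)
    else lerp ((z i).rep k) ((z' i).rep k)
  have e₁ : curveAt P 0 = fun i => (z i).rep := by
    funext i k
    by_cases hi : i.1 ≤ c
    · have := congrFun (hab i hi).1 k
      simp [curveAt, P, hi, this]
    · simp [curveAt, P, hi]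
  have e₂ : curveAt P 1 = fun i => (z' i).rep := by
    funext i k
    by_cases hi : i.1 ≤ c
    · have := congrFun (hab i hi).2 k
      simp [curveAt, P, hi, this]
    · simp [curveAt, P, hi]
  refine ⟨P, 0, 1, fun i => ?_, fun i => ?_, mkTuple_eq_of_rep _ e₁, mkTuple_eq_of_rep _ e₂,
    fun s hs hm => ⟨fun i hi => ?_, hm⟩⟩
  · rw [e₁]; exact (z i).rep_nonzero
  · rw [e₂]; exact (z' i).rep_nonzero
  · rw [mkTuple_mem_independentLocus]
    -- The base points need this as well, since the curve also writes them as combinations of the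
    -- interpolated base vectors.
    have key : ∀ j : Fin x, j.1 ≤ c → ∃ α β : 𝕜, curveAt P s j =
        α • (fun k => (lerp ((z i₀).rep k) ((z' i₀).rep k)).eval s) +
          β • (fun k => (lerp ((z i₁).rep k) ((z' i₁).rep k)).eval s) := fun j hj => by
      refine ⟨(lerp (a j) (a' j)).eval s, (lerp (b j) (b' j)).eval s, ?_⟩
      funext k
      simp only [curveAt, P, if_pos hj, Polynomial.eval_add, Polynomial.eval_mul, Pi.add_apply,
        Pi.smul_apply, smul_eq_mul]
    refine not_linearIndependent_of_mem_span_pair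
      (u := fun k => (lerp ((z i₀).rep k) ((z' i₀).rep k)).eval s)
      (v := fun k => (lerp ((z i₁).rep k) ((z' i₁).rep k)).eval s) fun l => ?_
    fin_cases l
    · exact key _ h₀
    · exact key _ h₁
    · exact key _ hi

lemma isIrreducible_image_forgetOrder {E : Set (ProjPow 𝕜 n x)} (hE : IsIrreducible E)
    (hinj : ∀ p ∈ E, Function.Injective (p : Fin x → PSpace 𝕜 n)) :
    IsIrreducible (forgetOrder '' (Subtype.val ⁻¹' E : Set (DistinctTuples 𝕜 n x))) :=
  (isIrreducible_preimage_val (K := {p : ProjPow 𝕜 n x |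
    Function.Injective (p : Fin x → PSpace 𝕜 n)}) hE hinj).image forgetOrder
      continuous_forgetOrder.continuousOn

lemma mem_spanningTuples_iff (p : DistinctTuples 𝕜 n x) :
    p.1 ∈ spanningTuples 𝕜 n x ↔ Spans (forgetOrder p).1 := by
  rw [spans_forgetOrder_iff]
  simp only [spanningTuples, Set.mem_inter_iff, Set.mem_iUnion]
  exact and_iff_right p.2

lemma containsCollinear_forgetOrder {c : ℕ} {i₀ i₁ : Fin x} (h₀₁ : i₀ ≠ i₁) (hcx : c + 1 ≤ x)
    {p : DistinctTuples 𝕜 n x} (hp : p.1 ∈ collinearTuples 𝕜 n c i₀ i₁) :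
    ContainsCollinear (forgetOrder p).1 (c + 1) := by
  classical
  let f : Fin (c + 1) ↪ PSpace 𝕜 n := ⟨fun i => p.1 (Fin.castLE hcx i),
    p.2.comp (Fin.castLE_injective hcx)⟩
  refine ⟨Finset.univ.map f, fun q hq => ?_, by simp, ?_⟩
  · obtain ⟨i, -, rfl⟩ := Finset.mem_map.1 hq
    exact (mem_forgetOrder _ _).2 ⟨_, rfl⟩
  · refine (isCollinear_iff_exists_submodule _).2
      ⟨Submodule.span 𝕜 {(p.1 i₀).rep, (p.1 i₁).rep}, finrank_span_pair_le _ _, fun q hq => ?_⟩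
    · obtain ⟨i, -, rfl⟩ := Finset.mem_map.1 (Finset.mem_coe.1 hq)
      obtain ⟨a, b, hab⟩ := exists_rep_eq_of_mem_collinearTuples h₀₁ p.2 hp (Fin.castLE hcx i)
        (Nat.lt_succ_iff.1 i.2)
      exact Submodule.mem_span_pair.2 ⟨a, b, hab.symm⟩

lemma exists_mem_collinearTuples {c : ℕ} {i₀ i₁ : Fin x} (h₀ : i₀.1 ≤ c) (h₁ : i₁.1 ≤ c)
    {S : PointSets 𝕜 n x} (hS : ContainsCollinear S.1 (c + 1)) :
    ∃ p : DistinctTuples 𝕜 n x, p.1 ∈ collinearTuples 𝕜 n c i₀ i₁ ∧ forgetOrder p = S := by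
  obtain ⟨A, hA, hcard, hcol⟩ := hS
  obtain ⟨p, hp, hpA⟩ := exists_forgetOrder_eq_of_subset S hA
  refine ⟨p, fun i hi => ?_, hp⟩
  have : ∀ j : Fin x, j.1 ≤ c → p.1 j ∈ A := fun j hj => hpA j (by omega)
  refine not_linearIndependent_of_isCollinear (v := fun l => p.1 ((![i₀, i₁, i] : Fin 3 → Fin x) l))
    hcol fun l => ?_
  fin_cases l
  · exact this _ h₀
  · exact this _ h₁
  · exact this _ hi

lemma setOf_containsCollinear_eq {c : ℕ} {i₀ i₁ : Fin x} (h₀₁ : i₀ ≠ i₁) (h₀ : i₀.1 ≤ c)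
    (h₁ : i₁.1 ≤ c) (hcx : c + 1 ≤ x) :
    {S : PointSets 𝕜 n x | ContainsCollinear S.1 (c + 1)} =
      forgetOrder '' (Subtype.val ⁻¹' collinearTuples 𝕜 n c i₀ i₁) := by
  ext S
  constructor
  · intro hS
    obtain ⟨p, hp, rfl⟩ := exists_mem_collinearTuples h₀ h₁ hS
    exact ⟨p, hp, rfl⟩
  · rintro ⟨p, hp, rfl⟩
    exact containsCollinear_forgetOrder h₀₁ hcx hp

/-- The sets of `x` points that span `ℙⁿ` and contain `c + 1` distinct collinear points. -/
def collinearLocus (𝕜 : Type*) [Field 𝕜] (n x c : ℕ) : Set (PointSets 𝕜 n x) :=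
  {S | Spans S.1 ∧ ContainsCollinear S.1 (c + 1)}

lemma collinearLocus_eq {c : ℕ} {i₀ i₁ : Fin x} (h₀₁ : i₀ ≠ i₁) (h₀ : i₀.1 ≤ c)
    (h₁ : i₁.1 ≤ c) (hcx : c + 1 ≤ x) :
    collinearLocus 𝕜 n x c = forgetOrder ''
      (Subtype.val ⁻¹' (collinearTuples 𝕜 n c i₀ i₁ ∩ spanningTuples 𝕜 n x)) := by
  ext S
  constructor
  · rintro ⟨hs, hS⟩
    obtain ⟨p, hp, rfl⟩ := exists_mem_collinearTuples h₀ h₁ hS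
    exact ⟨p, ⟨hp, (mem_spanningTuples_iff p).2 hs⟩, rfl⟩
  · rintro ⟨p, ⟨hp, hs⟩, rfl⟩
    exact ⟨(mem_spanningTuples_iff p).1 hs, containsCollinear_forgetOrder h₀₁ hcx hp⟩

/-- The homogeneous coordinates that remain free when the points `2, …, c` are written as linear
combinations of the points `0` and `1`: two for each of these points, all for the others. -/
abbrev FreeCoord (n x c : ℕ) : Type :=
  {k : Fin x × Fin (n + 1) // (k.1.1 ≤ 1 ∨ c < k.1.1) ∨ k.2.1 ≤ 1}

/-- Substitution of linear combinations of the points `i₀`, `i₁` for the points `2, …, c`. -/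
def collinearSubst (𝕜 : Type*) [Field 𝕜] (n : ℕ) {x : ℕ} (c : ℕ) {i₀ i₁ : Fin x} (h₀ : i₀.1 ≤ 1)
    (h₁ : i₁.1 ≤ 1) : MvPolynomial (Fin x × Fin (n + 1)) 𝕜 →ₐ[𝕜] MvPolynomial (FreeCoord n x c) 𝕜 :=
  MvPolynomial.aeval fun k => if h : k.1.1 ≤ 1 ∨ c < k.1.1 then MvPolynomial.X ⟨k, Or.inl h⟩ else
    MvPolynomial.X ⟨(k.1, 0), Or.inr (by simp)⟩ *
        MvPolynomial.X ⟨(i₀, k.2), Or.inl (Or.inl h₀)⟩ +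
      MvPolynomial.X ⟨(k.1, 1), Or.inr (Nat.mod_le _ _)⟩ *
        MvPolynomial.X ⟨(i₁, k.2), Or.inl (Or.inl h₁)⟩

lemma mul_add_eq_div_mul_add {F : Type*} [Field F] (u a b v w : F) {s t : F} (hs : s ≠ 0)
    (ht : t ≠ 0) : u * (a * v + b * w) = u * a / s * (s * v) + u * b / t * (t * w) := by
  field_simp

/-- The point `Xᵢ pᵢ` of the cone is a combination of `X_{i₀} p_{i₀}` and `X_{i₁} p_{i₁}` with
coefficients `Xᵢ aᵢ / X_{i₀}` and `Xᵢ bᵢ / X_{i₁}`. So `coneHom p` factors through the substitution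
after passing to the fraction field. -/
lemma coneHom_eq_zero_of_collinearSubst {c : ℕ} (hn : 1 ≤ n) {i₀ i₁ : Fin x} (h₀₁ : i₀ ≠ i₁)
    (h₀ : i₀.1 ≤ 1) (h₁ : i₁.1 ≤ 1) {p : ProjPow 𝕜 n x}
    (hinj : Function.Injective (p : Fin x → PSpace 𝕜 n))
    (hp : p ∈ collinearTuples 𝕜 n c i₀ i₁) (f : MvPolynomial (Fin x × Fin (n + 1)) 𝕜)
    (hf : collinearSubst 𝕜 n c h₀ h₁ f = 0) : coneHom p f = 0 := by
  classical
  let L := FractionRing (MvPolynomial (Fin x) 𝕜)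
  let ι : MvPolynomial (Fin x) 𝕜 →ₐ[𝕜] L := IsScalarTower.toAlgHom 𝕜 _ L
  have hι : Function.Injective ι := IsFractionRing.injective (MvPolynomial (Fin x) 𝕜) L
  have hX : ∀ i, ι (MvPolynomial.X i) ≠ 0 := fun i h =>
    MvPolynomial.X_ne_zero (R := 𝕜) i (hι (by rw [h, map_zero]))
  have hex : ∀ i : Fin x, ∃ a b : 𝕜, i.1 ≤ c →
      (p i).rep = a • (p i₀).rep + b • (p i₁).rep := fun i => by
    by_cases hi : i.1 ≤ c
    · obtain ⟨a, b, h⟩ := exists_rep_eq_of_mem_collinearTuples h₀₁ hinj hp i hi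
      exact ⟨a, b, fun _ => h⟩
    · exact ⟨0, 0, fun h => absurd h hi⟩
  choose a b hab using hex
  let v : Fin x → Fin (n + 1) → L := fun i k =>
    ι (MvPolynomial.X i * MvPolynomial.C ((p i).rep k))
  let θ : MvPolynomial (FreeCoord n x c) 𝕜 →ₐ[𝕜] L := MvPolynomial.aeval fun k =>
    if k.1.1.1 ≤ 1 ∨ c < k.1.1.1 then v k.1.1 k.1.2 else if k.1.2 = 0 then
      ι (MvPolynomial.X k.1.1 * MvPolynomial.C (a k.1.1)) / ι (MvPolynomial.X i₀) else
      ι (MvPolynomial.X k.1.1 * MvPolynomial.C (b k.1.1)) / ι (MvPolynomial.X i₁)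
  -- The coordinate slots 0 and 1 of a collinear point store its two coefficients, so they must
  -- differ.
  have h10 : (1 : Fin (n + 1)) ≠ 0 := by
    rw [Ne, Fin.ext_iff, Fin.val_one', Fin.val_zero, Nat.mod_eq_of_lt (by omega)]
    exact one_ne_zero
  have hθ : ι.comp (coneHom p) = θ.comp (collinearSubst 𝕜 n c h₀ h₁) := by
    refine MvPolynomial.algHom_ext fun k => ?_
    rw [AlgHom.comp_apply, AlgHom.comp_apply, coneHom, collinearSubst, MvPolynomial.aeval_X,
      MvPolynomial.aeval_X]
    by_cases h : k.1.1 ≤ 1 ∨ c < k.1.1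
    · rw [dif_pos h, MvPolynomial.aeval_X, if_pos h]
    · rw [dif_neg h, map_add θ, map_mul θ, map_mul θ]
      simp only [θ, MvPolynomial.aeval_X, if_true]
      rw [if_neg h, if_pos (Or.inl h₀), if_neg h, if_neg h10, if_pos (Or.inl h₁)]
      simp only [v, map_mul]
      rw [hab k.1 (by omega)]
      simp only [Pi.add_apply, Pi.smul_apply, smul_eq_mul, map_add, map_mul]
      exact mul_add_eq_div_mul_add _ _ _ _ _ (hX i₀) (hX i₁)
  apply hι
  rw [map_zero]
  have := AlgHom.congr_fun hθ f
  rw [AlgHom.comp_apply, AlgHom.comp_apply, hf, map_zero] at this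
  exact this

end CollinearTuples

/-! ### The upper bound for the dimension. -/

section DimensionUpperBound

variable {𝕜 : Type*} [Field 𝕜] {n x : ℕ}

/-- Serves both counts: n + 1 coordinates against 2 on the cone, n parameters against 1 in the
affine chart. -/
lemma sum_ite_collinear {x c : ℕ} (hc : 1 ≤ c) (hcx : c + 1 ≤ x) (A B : ℕ) :
    ∑ i : Fin x, (if i.1 ≤ 1 ∨ c < i.1 then A else B) = 2 * A + (c - 1) * B + (x - c - 1) * A := by
  obtain ⟨e, rfl⟩ : ∃ e, c = e + 1 := ⟨c - 1, by omega⟩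
  obtain ⟨m, rfl⟩ : ∃ m, x = 2 + e + m := ⟨x - (2 + e), by omega⟩
  rw [Fin.sum_univ_eq_sum_range (fun i => if i ≤ 1 ∨ e + 1 < i then A else B),
    Finset.sum_range_add, Finset.sum_range_add]
  have h1 : ∑ i ∈ Finset.range 2, (if i ≤ 1 ∨ e + 1 < i then A else B) = 2 * A := by
    rw [Finset.sum_congr rfl (g := fun _ => A) fun i hi => ?_]
    · simp
    · have := Finset.mem_range.1 hi
      rw [if_pos (by omega)]
  have h2 : ∑ i ∈ Finset.range e, (if 2 + i ≤ 1 ∨ e + 1 < 2 + i then A else B) = e * B := by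
    rw [Finset.sum_congr rfl (g := fun _ => B) fun i hi => ?_]
    · simp
    · have := Finset.mem_range.1 hi
      rw [if_neg (by omega)]
  have h3 : ∑ i ∈ Finset.range m, (if 2 + e + i ≤ 1 ∨ e + 1 < 2 + e + i then A else B) =
      m * A := by
    rw [Finset.sum_congr rfl (g := fun _ => A) fun i hi => ?_]
    · simp
    · rw [if_pos (by omega)]
  rw [h1, h2, h3]
  have e1 : e + 1 - 1 = e := by omega
  have e2 : 2 + e + m - (e + 1) - 1 = m := by omega
  rw [e1, e2]

lemma card_freeCoord {c : ℕ} (hn : 1 ≤ n) (hc : 1 ≤ c) (hcx : c + 1 ≤ x) :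
    Fintype.card (FreeCoord n x c) - x = c + n - 1 + n * (x - c) := by
  have h : Fintype.card (FreeCoord n x c) = 2 * (n + 1) + (c - 1) * 2 + (x - c - 1) * (n + 1) := by
    rw [Fintype.card_subtype, Finset.card_filter, Fintype.sum_prod_type,
      ← sum_ite_collinear hc hcx]
    refine Finset.sum_congr rfl fun i _ => ?_
    by_cases hi : i.1 ≤ 1 ∨ c < i.1
    · simp [hi]
    · simp only [hi, false_or, if_false]
      rw [Fin.sum_univ_eq_sum_range (fun k => if k ≤ 1 then 1 else 0)]
      obtain ⟨m, rfl⟩ : ∃ m, n = m + 1 := ⟨n - 1, by omega⟩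
      rw [show m + 1 + 1 = 2 + m by omega, Finset.sum_range_add]
      have : ∑ k ∈ Finset.range m, (if 2 + k ≤ 1 then 1 else 0) = 0 :=
        Finset.sum_eq_zero fun k _ => if_neg (by omega)
      rw [this]
      rfl
  rw [h]
  obtain ⟨e, rfl⟩ : ∃ e, c = e + 1 := ⟨c - 1, by omega⟩
  obtain ⟨m, rfl⟩ : ∃ m, x = e + 2 + m := ⟨x - (e + 2), by omega⟩
  have e1 : e + 1 - 1 = e := by omega
  have e2 : e + 2 + m - (e + 1) - 1 = m := by omega
  have e3 : e + 2 + m - (e + 1) = m + 1 := by omega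
  rw [e1, e2, e3, Nat.sub_eq_iff_eq_add (by nlinarith)]
  have e4 : e + 1 + n - 1 = e + n := by omega
  rw [e4]
  ring

theorem topologicalKrullDim_collinearLocus_le {c : ℕ} (hn : 1 ≤ n) (hc : 1 ≤ c)
    (hcx : c + 1 ≤ x) :
    topologicalKrullDim (collinearLocus 𝕜 n x c) ≤ (c + n - 1 + n * (x - c) : ℕ) := by
  let i₀ : Fin x := ⟨0, by omega⟩
  let i₁ : Fin x := ⟨1, by omega⟩
  have h₀₁ : i₀ ≠ i₁ := by simp [i₀, i₁]
  let X : Set (DistinctTuples 𝕜 n x) :=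
    Subtype.val ⁻¹' (collinearTuples 𝕜 n c i₀ i₁ ∩ spanningTuples 𝕜 n x)
  have hK : collinearLocus 𝕜 n x c = forgetOrder '' X :=
    collinearLocus_eq h₀₁ (Nat.zero_le _) hc hcx
  let f : X → collinearLocus 𝕜 n x c := fun p => ⟨forgetOrder p.1, hK ▸ ⟨p.1, p.2, rfl⟩⟩
  have hf : Continuous f :=
    (continuous_forgetOrder.comp continuous_subtype_val).subtype_mk _
  have hs : Function.Surjective f := fun S => by
    obtain ⟨p, hp, hpS⟩ := hK.subset S.2
    exact ⟨⟨p, hp⟩, Subtype.ext hpS⟩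
  -- Spanning depends only on the underlying set, so it can be dropped upstairs: the closed
  -- collinear tuples are pushed forward and the image is then restricted to the locus.
  have hcl : IsClosedMap f := by
    intro W hW
    obtain ⟨W', hW', rfl⟩ := isClosed_induced_iff.1 hW
    refine isClosed_induced_iff.2 ⟨_, isClosedMap_forgetOrder _ (hW'.inter
      ((isClosed_collinearTuples (𝕜 := 𝕜) (n := n) c i₀ i₁).preimage continuous_subtype_val)), ?_⟩
    ext S
    constructor
    · rintro ⟨p, ⟨hp, hpc⟩, hpS⟩
      have : p ∈ X := ⟨hpc, (mem_spanningTuples_iff p).2 (hpS ▸ S.2.1)⟩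
      exact ⟨⟨p, this⟩, hp, Subtype.ext hpS⟩
    · rintro ⟨p, hp, rfl⟩
      exact ⟨p.1, ⟨hp, p.2.1⟩, rfl⟩
  have hg : Topology.IsInducing fun p : X => p.1.1 :=
    Topology.IsInducing.subtypeVal.comp Topology.IsInducing.subtypeVal
  have := hg.noetherianSpace
  obtain ⟨r, hr, hN⟩ := exists_strictMono_rank hg
    (collinearSubst 𝕜 n c (i₀ := i₀) (i₁ := i₁) (Nat.zero_le _) le_rfl) fun p F hF =>
      coneHom_eq_zero_of_collinearSubst hn h₀₁ _ _ p.1.2 p.2.1 F hF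
  rw [card_freeCoord hn hc hcx] at hN
  exact topologicalKrullDim_le_of_isClosedMap hf hcl hs r hr hN

end DimensionUpperBound

/-! ### The lower bound: a chain of affine families. -/

section DimensionLowerBound

variable {𝕜 : Type*} [Field 𝕜] {n x : ℕ}

/-- Affine coordinates of a tuple whose points `2, …, c` lie on the line through the points `0`
and `1` and are given by their first coordinate in the affine parametrization of that line. -/
def affinePoint (c : ℕ) (i₀ i₁ : Fin x) (a : Fin x → Fin n → 𝕜) (k₀ : Fin n)
    (i : Fin x) (k : Fin n) : 𝕜 :=
  if i.1 ≤ 1 ∨ c < i.1 then a i k else a i₀ k + a i k₀ * (a i₁ k - a i₀ k)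

/-- The homogeneous coordinates of the points with affine coordinates `affinePoint`. -/
def affineTuple (c : ℕ) (i₀ i₁ : Fin x) (a : Fin x → Fin n → 𝕜) (k₀ : Fin n) :
    Fin x → Fin (n + 1) → 𝕜 :=
  fun i => Fin.cons 1 (affinePoint c i₀ i₁ a k₀ i)

lemma affineTuple_ne_zero (c : ℕ) (i₀ i₁ : Fin x) (a : Fin x → Fin n → 𝕜) (k₀ : Fin n)
    (i : Fin x) : affineTuple c i₀ i₁ a k₀ i ≠ 0 := fun h => by
  have := congrFun h 0
  simp [affineTuple] at this

/-- The polynomial curve of affine tuples along the line through the parameters `a` and `b`. -/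
def affineCurve (c : ℕ) (i₀ i₁ : Fin x) (a b : Fin x → Fin n → 𝕜) (k₀ : Fin n) :
    Fin x → Fin (n + 1) → Polynomial 𝕜 :=
  fun i => Fin.cons 1 fun k =>
    if i.1 ≤ 1 ∨ c < i.1 then lerp (a i k) (b i k) else
      lerp (a i₀ k) (b i₀ k) + lerp (a i k₀) (b i k₀) *
        (lerp (a i₁ k) (b i₁ k) - lerp (a i₀ k) (b i₀ k))

lemma curveAt_affineCurve (c : ℕ) (i₀ i₁ : Fin x) (a b : Fin x → Fin n → 𝕜) (k₀ : Fin n) (s : 𝕜) :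
    curveAt (affineCurve c i₀ i₁ a b k₀) s =
      affineTuple c i₀ i₁ (fun i k => a i k + s * (b i k - a i k)) k₀ := by
  funext i k
  refine Fin.cases ?_ (fun k => ?_) k
  · simp [curveAt, affineCurve, affineTuple]
  · simp only [curveAt, affineCurve, affineTuple, Fin.cons_succ, affinePoint]
    split_ifs <;> simp

lemma affineTuple_mem_collinearTuples {c : ℕ} {i₀ i₁ : Fin x} (h₀ : i₀.1 ≤ 1)
    (h₁ : i₁.1 ≤ 1) (h₀₁ : i₀ ≠ i₁) (a : Fin x → Fin n → 𝕜) (k₀ : Fin n) :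
    mkTuple _ (affineTuple_ne_zero c i₀ i₁ a k₀) ∈ collinearTuples 𝕜 n c i₀ i₁ := by
  intro i hi
  rw [mkTuple_mem_independentLocus]
  have e₀ : affineTuple c i₀ i₁ a k₀ i₀ = Fin.cons 1 (a i₀) := by
    simp only [affineTuple]
    congr 1
    funext k
    simp [affinePoint, h₀]
  have e₁ : affineTuple c i₀ i₁ a k₀ i₁ = Fin.cons 1 (a i₁) := by
    simp only [affineTuple]
    congr 1
    funext k
    simp [affinePoint, h₁]
  have key : ∃ α β : 𝕜, affineTuple c i₀ i₁ a k₀ i =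
      α • (Fin.cons 1 (a i₀) : Fin (n + 1) → 𝕜) + β • (Fin.cons 1 (a i₁) : Fin (n + 1) → 𝕜) := by
    by_cases hi1 : i.1 ≤ 1
    · have : i = i₀ ∨ i = i₁ := by
        have : i₀.1 ≠ i₁.1 := fun h => h₀₁ (Fin.ext h)
        rw [Fin.ext_iff, Fin.ext_iff]
        omega
      rcases this with rfl | rfl
      · exact ⟨1, 0, by rw [e₀]; simp⟩
      · exact ⟨0, 1, by rw [e₁]; simp⟩
    · refine ⟨1 - a i k₀, a i k₀, ?_⟩
      funext k
      refine Fin.cases ?_ (fun k => ?_) k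
      · simp [affineTuple]
      · have : ¬(i.1 ≤ 1 ∨ c < i.1) := by omega
        simp only [affineTuple, Fin.cons_succ, affinePoint, this, if_false, Pi.add_apply,
          Pi.smul_apply, smul_eq_mul]
        ring
  refine not_linearIndependent_of_mem_span_pair (u := Fin.cons 1 (a i₀))
    (v := Fin.cons 1 (a i₁)) fun l => ?_
  fin_cases l
  · exact ⟨1, 0, by simpa using e₀⟩
  · exact ⟨0, 1, by simpa using e₁⟩
  · exact key

/-- The tuples given by affine parameters that agree with `a` on the set `Q` of indices. -/
def affineLocus (c : ℕ) (i₀ i₁ : Fin x) (a : Fin x → Fin n → 𝕜) (k₀ : Fin n)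
    (Q : Set (Fin x × Fin n)) : Set (ProjPow 𝕜 n x) :=
  {p | p ∈ spanningTuples 𝕜 n x ∧ ∃ b : Fin x → Fin n → 𝕜, (∀ q ∈ Q, b q.1 q.2 = a q.1 q.2) ∧
    mkTuple _ (affineTuple_ne_zero c i₀ i₁ b k₀) = p}

lemma mkTuple_congr {y : ℕ} {a b : Fin y → Fin (n + 1) → 𝕜} (h : a = b) (ha : ∀ i, a i ≠ 0)
    (hb : ∀ i, b i ≠ 0) : mkTuple a ha = mkTuple b hb := by
  subst h
  rfl

lemma isPreirreducible_affineLocus [Infinite 𝕜] (c : ℕ) (i₀ i₁ : Fin x) (a : Fin x → Fin n → 𝕜)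
    (k₀ : Fin n) (Q : Set (Fin x × Fin n)) :
    IsPreirreducible (affineLocus c i₀ i₁ a k₀ Q) := by
  refine isPreirreducible_of_curves isOpen_spanningTuples (fun p hp => hp.1) ?_
  rintro _ ⟨-, b, hb, rfl⟩ _ ⟨-, b', hb', rfl⟩
  have h := curveAt_affineCurve c i₀ i₁ b b' k₀
  refine ⟨affineCurve c i₀ i₁ b b' k₀, 0, 1, fun i => ?_, fun i => ?_, ?_, ?_, fun s hs hm =>
    ⟨hm, fun i k => b i k + s * (b' i k - b i k), fun q hq => ?_, ?_⟩⟩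
  · rw [h]; exact affineTuple_ne_zero _ _ _ _ _ _
  · rw [h]; exact affineTuple_ne_zero _ _ _ _ _ _
  · exact mkTuple_congr (by rw [h]; simp) _ _
  · exact mkTuple_congr (by rw [h]; simp) _ _
  · dsimp only
    rw [hb q hq, hb' q hq]
    ring
  · exact mkTuple_congr (h s).symm _ _

lemma injective_mkTuple_affineTuple {c : ℕ} {i₀ i₁ : Fin x} {a : Fin x → Fin n → 𝕜} {k₀ : Fin n}
    (k : Fin n) (h : Function.Injective fun i => affinePoint c i₀ i₁ a k₀ i k) :
    Function.Injective (mkTuple _ (affineTuple_ne_zero c i₀ i₁ a k₀) : Fin x → PSpace 𝕜 n) := by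
  intro i j hij
  rw [mkTuple_apply, mkTuple_apply, Projectivization.mk_eq_mk_iff'] at hij
  obtain ⟨l, hl⟩ := hij
  have h0 := congrFun hl 0
  have hk := congrFun hl k.succ
  simp only [affineTuple, Pi.smul_apply, Fin.cons_zero, smul_eq_mul, mul_one,
    Fin.cons_succ] at h0 hk
  rw [h0, one_mul] at hk
  exact (h hk).symm

lemma rep_mk_succ_eq_iff (w : Fin n → 𝕜) (hw : (Fin.cons 1 w : Fin (n + 1) → 𝕜) ≠ 0) (k : Fin n)
    (α : 𝕜) : (Projectivization.mk 𝕜 (Fin.cons 1 w : Fin (n + 1) → 𝕜) hw).rep k.succ =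
      α * (Projectivization.mk 𝕜 (Fin.cons 1 w : Fin (n + 1) → 𝕜) hw).rep 0 ↔ w k = α := by
  obtain ⟨l, hl⟩ := Projectivization.exists_smul_eq_mk_rep 𝕜 (Fin.cons 1 w : Fin (n + 1) → 𝕜) hw
  rw [← hl]
  simp only [Units.smul_def, Pi.smul_apply, Fin.cons_succ, Fin.cons_zero, smul_eq_mul, mul_one]
  rw [mul_comm, mul_left_inj' l.ne_zero]

/-- The sets of points one of which lies in the hyperplane `X_{k+1} = α X_0`. -/
def hyperplaneLocus (x : ℕ) (k : Fin n) (α : 𝕜) : Set (PointSets 𝕜 n x) :=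
  {S | ∃ r ∈ S.1, r.rep k.succ = α * r.rep 0}

/-- A closed condition on unordered sets has to be symmetric. It asks that some point lie in the
hyperplane, since the `i`-th point is not defined. -/
lemma isClosed_hyperplaneLocus (k : Fin n) (α : 𝕜) : IsClosed (hyperplaneLocus x k α) := by
  rw [isClosed_coinduced]
  have : forgetOrder ⁻¹' hyperplaneLocus x k α =
      ⋃ i : Fin x, Subtype.val ⁻¹' (nonvanishingLocus (𝕜 := 𝕜)
        (MvPolynomial.X (i, k.succ) - MvPolynomial.C α * MvPolynomial.X (i, 0)))ᶜ := by
    ext p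
    simp only [hyperplaneLocus, Set.mem_preimage, Set.mem_ofPred_eq, Set.mem_iUnion,
      Set.mem_compl_iff, nonvanishingLocus, mem_forgetOrder]
    constructor
    · rintro ⟨_, ⟨i, rfl⟩, h⟩
      exact ⟨i, by simp [h]⟩
    · rintro ⟨i, h⟩
      exact ⟨_, ⟨i, rfl⟩, by simpa [sub_eq_zero] using h⟩
  rw [this]
  refine isClosed_iUnion_of_finite fun i => IsClosed.preimage continuous_subtype_val
    (isOpen_nonvanishingLocus (e := Pi.single i 1) ?_).isClosed_compl
  exact (MvPolynomial.isWeightedHomogeneous_X 𝕜 _ (i, k.succ)).sub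
    ((MvPolynomial.isWeightedHomogeneous_X 𝕜 _ (i, (0 : Fin (n + 1)))).C_mul α)

/-- Parameters of a tuple of points with `c + 1` points on the diagonal of affine space and the
others on the moment curve. -/
def momentParam (𝕜 : Type*) [Field 𝕜] (n x c : ℕ) : Fin x → Fin n → 𝕜 :=
  fun i k => if i.1 ≤ c then (i.1 : 𝕜) else (i.1 : 𝕜) ^ (k.1 + 1)

/-- Points 0 and 1 are the zero vector and the all-ones vector, so line parameter `i` gives the
diagonal point with all coordinates `i`. -/
lemma affinePoint_momentParam {c : ℕ} (hc : 1 ≤ c) {i₀ i₁ : Fin x} (h₀ : i₀.1 = 0)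
    (h₁ : i₁.1 = 1) (k₀ : Fin n) :
    affinePoint c i₀ i₁ (momentParam 𝕜 n x c) k₀ = momentParam 𝕜 n x c := by
  funext i k
  by_cases hi : i.1 ≤ 1 ∨ c < i.1
  · simp [affinePoint, hi]
  · have : i.1 ≤ c := by omega
    simp [affinePoint, hi, momentParam, h₀, h₁, hc, this]

/-- Each coordinate increases strictly with `i`, also across the change of formula after `c`. So a
hyperplane fixing one coordinate meets the tuple in one point only. -/
lemma injective_momentParam [CharZero 𝕜] (c : ℕ) (k : Fin n) :
    Function.Injective fun i => momentParam 𝕜 n x c i k := by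
  have h : (fun i => momentParam 𝕜 n x c i k) =
      fun i => (((if i.1 ≤ c then i.1 else i.1 ^ (k.1 + 1) : ℕ)) : 𝕜) := by
    funext i
    simp only [momentParam]
    split_ifs <;> simp
  rw [h]
  refine Nat.cast_injective.comp (StrictMono.injective ?_)
  intro i j hij
  have hij' : i.1 < j.1 := hij
  have hj : j.1 ≤ j.1 ^ (k.1 + 1) := Nat.le_self_pow (by omega) _
  have hp : i.1 ^ (k.1 + 1) < j.1 ^ (k.1 + 1) := Nat.pow_lt_pow_left hij' (by omega)
  dsimp only
  split_ifs <;> omega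

lemma mkTuple_momentParam_mem_spanningTuples [CharZero 𝕜] {c : ℕ} (hc : 1 ≤ c) (hcx : n + c ≤ x)
    {i₀ i₁ : Fin x} (h₀ : i₀.1 = 0) (h₁ : i₁.1 = 1) (k₀ : Fin n) :
    mkTuple _ (affineTuple_ne_zero c i₀ i₁ (momentParam 𝕜 n x c) k₀) ∈ spanningTuples 𝕜 n x := by
  have hx : 1 < x := h₁ ▸ i₁.2
  refine ⟨injective_mkTuple_affineTuple k₀ ?_, Set.mem_iUnion.2 ?_⟩
  · rw [affinePoint_momentParam hc h₀ h₁]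
    exact injective_momentParam c k₀
  -- Points 0, 1, c + 1, …, c + n - 1: the first two lie on the moment curve as well, because 0 and
  -- 1 equal their positive powers. So the matrix is Vandermonde.
  · let e : Fin (n + 1) → Fin x := fun j =>
      ⟨if j.1 ≤ 1 then j.1 else c + j.1 - 1, by have := j.2; split_ifs <;> omega⟩
    have he : Function.Injective e := by
      intro i j hij
      have := congrArg Fin.val hij
      simp only [e] at this
      apply Fin.ext
      split_ifs at this <;> omega
    refine ⟨e, ?_⟩
    rw [mkTuple_mem_independentLocus]
    have hv : (fun j => affineTuple c i₀ i₁ (momentParam 𝕜 n x c) k₀ (e j)) =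
        (Matrix.vandermonde fun j => ((e j).1 : 𝕜)).row := by
      funext j k
      refine Fin.cases ?_ (fun k => ?_) k
      · simp [affineTuple, Matrix.vandermonde]
      · simp only [affineTuple, Fin.cons_succ, affinePoint_momentParam hc h₀ h₁, momentParam,
          Matrix.row, Matrix.vandermonde, Matrix.of_apply, Fin.val_succ]
        by_cases hj : j.1 ≤ 1
        · have hej : (e j).1 = j.1 := if_pos hj
          rw [hej, if_pos (by omega)]
          have : j.1 = 0 ∨ j.1 = 1 := by omega
          rcases this with h | h <;> simp [h]
        · have hej : (e j).1 = c + j.1 - 1 := if_neg hj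
          rw [if_neg (by omega)]
    rw [hv]
    exact Matrix.linearIndependent_rows_of_det_ne_zero
      (Matrix.det_vandermonde_ne_zero_iff.2 (Nat.cast_injective.comp (Fin.val_injective.comp he)))

lemma card_affineParam {c : ℕ} (k₀ : Fin n) (hc : 1 ≤ c) (hcx : c + 1 ≤ x) :
    (Finset.univ.filter fun q : Fin x ×ₗ Fin n =>
      ((ofLex q).1.1 ≤ 1 ∨ c < (ofLex q).1.1) ∨ (ofLex q).2 = k₀).card =
        c + n - 1 + n * (x - c) := by
  have hn : 1 ≤ n := k₀.pos
  have h : (Finset.univ.filter fun q : Fin x × Fin n =>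
      (q.1.1 ≤ 1 ∨ c < q.1.1) ∨ q.2 = k₀).card = 2 * n + (c - 1) * 1 + (x - c - 1) * n := by
    rw [Finset.card_filter, Fintype.sum_prod_type, ← sum_ite_collinear hc hcx]
    refine Finset.sum_congr rfl fun i _ => ?_
    by_cases hi : i.1 ≤ 1 ∨ c < i.1
    · simp [hi]
    · simp [hi]
  have h' : (Finset.univ.filter fun q : Fin x ×ₗ Fin n =>
      ((ofLex q).1.1 ≤ 1 ∨ c < (ofLex q).1.1) ∨ (ofLex q).2 = k₀).card =
        (Finset.univ.filter fun q : Fin x × Fin n =>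
          (q.1.1 ≤ 1 ∨ c < q.1.1) ∨ q.2 = k₀).card :=
    Finset.card_bij (fun q _ => ofLex q) (by simp) (by simp) (by simp)
  rw [h', h]
  obtain ⟨e, rfl⟩ : ∃ e, c = e + 1 := ⟨c - 1, by omega⟩
  obtain ⟨m, rfl⟩ : ∃ m, x = e + 2 + m := ⟨x - (e + 2), by omega⟩
  have e1 : e + 1 - 1 = e := by omega
  have e2 : e + 2 + m - (e + 1) - 1 = m := by omega
  have e3 : e + 2 + m - (e + 1) = m + 1 := by omega
  have e4 : e + 1 + n - 1 = e + n := by omega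
  rw [e1, e2, e3, e4]
  ring

lemma affineLocus_anti (c : ℕ) (i₀ i₁ : Fin x) (a : Fin x → Fin n → 𝕜) (k₀ : Fin n)
    {Q Q' : Set (Fin x × Fin n)} (h : Q ⊆ Q') :
    affineLocus c i₀ i₁ a k₀ Q' ⊆ affineLocus c i₀ i₁ a k₀ Q := by
  rintro p ⟨hp, b, hb, rfl⟩
  exact ⟨hp, b, fun q hq => hb q (h hq), rfl⟩

/-- Along the line moving only the parameter `(i, k)`, every point leaves the hyperplane for generic
`s`, so no point of the tuple satisfies the symmetric condition. -/
lemma exists_mem_affineLocus_forall_ne [Infinite 𝕜] {c : ℕ} {i₀ i₁ : Fin x} (h₀ : i₀.1 ≤ 1)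
    (h₁ : i₁.1 ≤ 1) {a : Fin x → Fin n → 𝕜} {k₀ : Fin n}
    (ha : mkTuple _ (affineTuple_ne_zero c i₀ i₁ a k₀) ∈ spanningTuples 𝕜 n x)
    (hinj : ∀ k, Function.Injective fun i => affinePoint c i₀ i₁ a k₀ i k)
    (h₀₁ : a i₀ k₀ ≠ a i₁ k₀) {i : Fin x} {k : Fin n} (hik : (i.1 ≤ 1 ∨ c < i.1) ∨ k = k₀)
    {Q : Set (Fin x × Fin n)} (hQ : (i, k) ∉ Q) :
    ∃ b : Fin x → Fin n → 𝕜, mkTuple _ (affineTuple_ne_zero c i₀ i₁ b k₀) ∈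
        affineLocus c i₀ i₁ a k₀ Q ∧
      ∀ j, affinePoint c i₀ i₁ b k₀ j k ≠ affinePoint c i₀ i₁ a k₀ i k := by
  classical
  let a' : Fin x → Fin n → 𝕜 := fun i' k' => if (i', k') = (i, k) then a i k + 1 else a i' k'
  let P := affineCurve c i₀ i₁ a a' k₀
  let α := affinePoint c i₀ i₁ a k₀ i k
  have heval : ∀ (j : Fin x) (s : 𝕜), (P j k.succ).eval s =
      affinePoint c i₀ i₁ (fun i k => a i k + s * (a' i k - a i k)) k₀ j k := fun j s =>
    congrFun (congrFun (curveAt_affineCurve c i₀ i₁ a a' k₀ s) j) k.succ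
  have hg : ∏ j, (P j k.succ - Polynomial.C α) ≠ 0 := by
    refine Finset.prod_ne_zero_iff.2 fun j _ h => ?_
    -- Point `i` is off the hyperplane at `s = 1`: its coordinate has moved by 1, or by `a i₁ k₀ - a
    -- i₀ k₀` if it is a line parameter. Every other point is off it already at `s = 0`, by
    -- injectivity.
    by_cases hj : j = i
    · subst hj
      have := congrArg (Polynomial.eval 1) h
      rw [Polynomial.eval_sub, heval] at this
      simp only [one_mul, add_sub_cancel, Polynomial.eval_C, Polynomial.eval_zero, α] at this
      by_cases hjc : j.1 ≤ 1 ∨ c < j.1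
      · simp [affinePoint, hjc, a'] at this
      · have hk : k = k₀ := hik.resolve_left hjc
        subst hk
        have n₀ : i₀ ≠ j := fun h => hjc (Or.inl (h ▸ h₀))
        have n₁ : i₁ ≠ j := fun h => hjc (Or.inl (h ▸ h₁))
        simp only [affinePoint, hjc, if_false, a', Prod.mk.injEq, n₀, n₁, false_and, and_self,
          if_true] at this
        apply h₀₁
        linear_combination -this
    · have := congrArg (Polynomial.eval 0) h
      rw [Polynomial.eval_sub, heval] at this
      simp only [zero_mul, add_zero, Polynomial.eval_C, Polynomial.eval_zero, α] at this
      exact hj (hinj k (sub_eq_zero.1 this))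
  have h0 : ∀ j, curveAt P 0 j ≠ 0 := fun j => by
    rw [curveAt_affineCurve]
    exact affineTuple_ne_zero _ _ _ _ _ _
  have h0m : mkTuple _ h0 ∈ spanningTuples 𝕜 n x := by
    rw [mkTuple_congr (b := affineTuple c i₀ i₁ a k₀) (by rw [curveAt_affineCurve]; simp) h0
      (affineTuple_ne_zero _ _ _ _ _)]
    exact ha
  obtain ⟨s, hs, hm, hgs⟩ := exists_curveAt_mem P h0 h0 isOpen_spanningTuples
    isOpen_spanningTuples h0m h0m _ hg
  let b : Fin x → Fin n → 𝕜 := fun i k => a i k + s * (a' i k - a i k)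
  have hb : mkTuple _ hs = mkTuple _ (affineTuple_ne_zero c i₀ i₁ b k₀) :=
    mkTuple_congr (curveAt_affineCurve c i₀ i₁ a a' k₀ s) _ _
  refine ⟨b, ⟨hb ▸ hm.1, b, fun q hq => ?_, rfl⟩, fun j hj => ?_⟩
  · have : (q.1, q.2) ≠ (i, k) := fun h => hQ (h ▸ hq)
    simp only [b, a', this, if_false, sub_self, mul_zero, add_zero]
  · rw [Polynomial.eval_prod, Finset.prod_ne_zero_iff] at hgs
    apply hgs j (Finset.mem_univ _)
    rw [Polynomial.eval_sub, heval, Polynomial.eval_C, sub_eq_zero]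
    exact hj

theorem le_topologicalKrullDim_collinearLocus [CharZero 𝕜] {c : ℕ} (hn : 1 ≤ n) (hc : 1 ≤ c)
    (hcx : n + c ≤ x) :
    ((c + n - 1 + n * (x - c) : ℕ) : WithBot ℕ∞) ≤
      topologicalKrullDim (collinearLocus 𝕜 n x c) := by
  classical
  let i₀ : Fin x := ⟨0, by omega⟩
  let i₁ : Fin x := ⟨1, by omega⟩
  have h₀₁ : i₀ ≠ i₁ := by simp [i₀, i₁]
  let k₀ : Fin n := ⟨0, hn⟩
  let a := momentParam 𝕜 n x c
  have ha : affinePoint c i₀ i₁ a k₀ = a := affinePoint_momentParam hc rfl rfl k₀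
  have has : mkTuple _ (affineTuple_ne_zero c i₀ i₁ a k₀) ∈ spanningTuples 𝕜 n x :=
    mkTuple_momentParam_mem_spanningTuples hc hcx rfl rfl k₀
  let en := Finset.orderEmbOfFin _ (card_affineParam (x := x) k₀ hc (by omega))
  -- The first `j` parameters in lexicographic order are frozen.
  let Q : ℕ → Set (Fin x × Fin n) := fun j => {q | ∃ l, l.1 < j ∧ en l = toLex q}
  have hK : collinearLocus 𝕜 n x c = _ := collinearLocus_eq h₀₁ (Nat.zero_le _) hc (by omega)
  have hsub : ∀ Q, forgetOrder '' (Subtype.val ⁻¹' affineLocus c i₀ i₁ a k₀ Q) ⊆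
      collinearLocus 𝕜 n x c := fun Q => by
    rw [hK]
    refine Set.image_mono (Set.preimage_mono ?_)
    rintro _ ⟨hp, b, -, rfl⟩
    exact ⟨affineTuple_mem_collinearTuples (Nat.zero_le _) le_rfl h₀₁ b k₀, hp⟩
  refine le_topologicalKrullDim_of_chain (fun j => Subtype.val ⁻¹' (forgetOrder ''
    (Subtype.val ⁻¹' affineLocus c i₀ i₁ a k₀ (Q j)))) (fun j _ => ?_) (fun j _ => ?_)
    (fun j hj => ?_)
  · refine isIrreducible_preimage_val (isIrreducible_image_forgetOrder
      ⟨⟨_, has, a, fun _ _ => rfl, rfl⟩, isPreirreducible_affineLocus _ _ _ _ _ _⟩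
      fun p hp => hp.1.1) (hsub _)
  · refine Set.preimage_mono (Set.image_mono (Set.preimage_mono (affineLocus_anti _ _ _ _ _ ?_)))
    rintro q ⟨l, hl, h⟩
    exact ⟨l, hl.trans (Nat.lt_succ_self j), h⟩
  · obtain ⟨⟨i, k⟩, hik⟩ : ∃ q : Fin x × Fin n, en ⟨j, hj⟩ = toLex q := ⟨ofLex (en ⟨j, hj⟩), rfl⟩
    have hmem : (i.1 ≤ 1 ∨ c < i.1) ∨ k = k₀ := by
      have := Finset.orderEmbOfFin_mem _ (card_affineParam (x := x) k₀ hc (by omega)) ⟨j, hj⟩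
      rw [Finset.mem_filter] at this
      have h2 := this.2
      rw [show Finset.orderEmbOfFin _ _ ⟨j, hj⟩ = toLex (i, k) from hik] at h2
      exact h2
    refine ⟨Subtype.val ⁻¹' hyperplaneLocus x k (a i k),
      (isClosed_hyperplaneLocus k (a i k)).preimage continuous_subtype_val, ?_, ?_⟩
    · refine Set.preimage_mono ?_
      rintro _ ⟨⟨_, hinj⟩, ⟨hp, b, hb, rfl⟩, rfl⟩
      refine ⟨_, (mem_forgetOrder _ _).2 ⟨i, rfl⟩, ?_⟩
      refine (rep_mk_succ_eq_iff _ (affineTuple_ne_zero c i₀ i₁ b k₀ i) k (a i k)).2 ?_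
      have hbik : b i k = a i k := hb (i, k) ⟨⟨j, hj⟩, Nat.lt_succ_self j, hik⟩
      by_cases hi : i.1 ≤ 1 ∨ c < i.1
      · simp only [affinePoint, hi, if_true, hbik]
      · have hk : k = k₀ := hmem.resolve_left hi
        subst hk
        -- A coordinate of a point on the line also depends on points 0 and 1. The lexicographic
        -- order freezes their parameters first, so freezing the line parameter fixes the coordinate
        -- `k₀`.
        have hbl : ∀ l : Fin x, l.1 ≤ 1 → b l k₀ = a l k₀ := fun l hl => by
          have hlS : toLex (l, k₀) ∈ Finset.univ.filter fun q : Fin x ×ₗ Fin n =>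
              ((ofLex q).1.1 ≤ 1 ∨ c < (ofLex q).1.1) ∨ (ofLex q).2 = k₀ := by
            simp
          rw [← Finset.mem_coe, ← Finset.range_orderEmbOfFin _
            (card_affineParam (x := x) k₀ hc (by omega))] at hlS
          obtain ⟨m, hm⟩ := hlS
          refine hb (l, k₀) ⟨m, ?_, hm⟩
          have : en m < en ⟨j, hj⟩ := by
            rw [hik, show en m = toLex (l, k₀) from hm, Prod.Lex.toLex_lt_toLex]
            left
            rw [Fin.lt_def]
            dsimp only
            omega
          have := en.lt_iff_lt.1 this
          exact (Fin.lt_def.1 this).trans (Nat.lt_succ_self j)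
        rw [← congrFun (congrFun ha i) k₀]
        simp only [affinePoint, hi, if_false, hbik, hbl i₀ (Nat.zero_le _), hbl i₁ le_rfl]
    · intro hsubset
      have hQ : (i, k) ∉ Q j := by
        rintro ⟨l, hl, h⟩
        have := en.injective (h.trans hik.symm)
        subst this
        exact lt_irrefl _ hl
      obtain ⟨b, hb, hbne⟩ := exists_mem_affineLocus_forall_ne (Nat.zero_le _) le_rfl has
        (fun k => by rw [ha]; exact injective_momentParam c k)
        (by simp [a, momentParam, i₀, i₁, hc]) hmem hQ
      have hS : forgetOrder ⟨_, hb.1.1⟩ ∈ forgetOrder ''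
          (Subtype.val ⁻¹' affineLocus c i₀ i₁ a k₀ (Q j)) := ⟨_, hb, rfl⟩
      obtain ⟨r, hr, hrk⟩ := hsubset (a := ⟨_, hsub _ hS⟩) hS
      obtain ⟨l, rfl⟩ := (mem_forgetOrder _ _).1 hr
      apply hbne l
      rw [ha]
      exact (rep_mk_succ_eq_iff _ (affineTuple_ne_zero c i₀ i₁ b k₀ l) k (a i k)).1 hrk

end DimensionLowerBound

/-! ### The spread. -/

section Spread

variable {𝕜 : Type*} [Field 𝕜] {n x : ℕ}

lemma nonempty_spanningTuples [CharZero 𝕜] {y : ℕ} (hn : 1 ≤ n) (hy : n + 1 ≤ y) :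
    (spanningTuples 𝕜 n y).Nonempty :=
  ⟨_, mkTuple_momentParam_mem_spanningTuples le_rfl hy (i₀ := ⟨0, by omega⟩)
    (i₁ := ⟨1, by omega⟩) rfl rfl ⟨0, hn⟩⟩

lemma add_smul_rep_ne_zero {p q : PSpace 𝕜 n} (h : p ≠ q) (t : 𝕜) : p.rep + t • q.rep ≠ 0 := by
  intro h0
  have := LinearIndependent.pair_iff.1 (Projectivization.linearIndependent_pair_iff_ne.2 h) 1 t
    (by rw [one_smul, h0])
  exact one_ne_zero this.1

/-- The points of the line through `p` and `q` other than `q`. -/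
def linePoint {p q : PSpace 𝕜 n} (h : p ≠ q) (t : 𝕜) : PSpace 𝕜 n :=
  Projectivization.mk 𝕜 (p.rep + t • q.rep) (add_smul_rep_ne_zero h t)

lemma injective_linePoint {p q : PSpace 𝕜 n} (h : p ≠ q) : Function.Injective (linePoint h) := by
  intro s t hst
  rw [linePoint, linePoint, Projectivization.mk_eq_mk_iff'] at hst
  obtain ⟨a, ha⟩ := hst
  have := LinearIndependent.pair_iff.1 (Projectivization.linearIndependent_pair_iff_ne.2 h)
    (a - 1) (a * t - s) (by
      rw [smul_add, smul_smul] at ha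
      rw [sub_smul, sub_smul, one_smul, sub_add_sub_comm, ha, sub_self])
  have ha1 : a = 1 := sub_eq_zero.1 this.1
  have := this.2
  rw [ha1, one_mul] at this
  exact (sub_eq_zero.1 this).symm

lemma linePoint_rep_mem {p q : PSpace 𝕜 n} (h : p ≠ q) (t : 𝕜) :
    (linePoint h t).rep ∈ Submodule.span 𝕜 {p.rep, q.rep} := by
  obtain ⟨l, hl⟩ := Projectivization.exists_smul_eq_mk_rep 𝕜 _ (add_smul_rep_ne_zero h t)
  rw [linePoint, ← hl]
  refine Submodule.smul_mem _ (l : 𝕜) (Submodule.mem_span_pair.2 ⟨1, t, by rw [one_smul]⟩)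

/-- The remaining c - 1 points can be placed on the line through the first two; spanning is
inherited from the given points. -/
lemma spanningTuples_subset_image_firstFactors [Infinite 𝕜] {c : ℕ}
    (hcx : c + 1 ≤ x) (h : x - c + 1 ≤ x) :
    spanningTuples 𝕜 n (x - c + 1) ⊆
      firstFactors h '' (forgetOrder ⁻¹' collinearLocus 𝕜 n x c) := by
  classical
  intro p hp
  let j₀ : Fin (x - c + 1) := ⟨0, by omega⟩
  let j₁ : Fin (x - c + 1) := ⟨1, by omega⟩
  have h₀₁ : p j₀ ≠ p j₁ := fun h => by
    have := hp.1 h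
    simp [j₀, j₁] at this
  -- Only finitely many line parameters hit given points; the new points use pairwise distinct other
  -- parameters.
  have hfin : {t : 𝕜 | linePoint h₀₁ t ∈ Set.range p}.Finite :=
    (Set.finite_range p).preimage (injective_linePoint h₀₁).injOn
  let g := hfin.infinite_compl.natEmbedding
  have hg : ∀ m j, linePoint h₀₁ (g m) ≠ p j := fun m j hj => (g m).2 ⟨j, hj.symm⟩
  let p' : Fin x → PSpace 𝕜 n := fun i =>
    if hi : i.1 < x - c + 1 then p ⟨i.1, hi⟩ else linePoint h₀₁ (g i.1)
  have hp' : Function.Injective p' := by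
    intro i j hij
    simp only [p'] at hij
    split_ifs at hij with hi hj hj
    · exact Fin.ext (Fin.mk.inj_iff.1 (hp.1 hij))
    · exact absurd hij.symm (hg _ _)
    · exact absurd hij (hg _ _)
    · exact Fin.ext (g.injective (Subtype.ext (injective_linePoint h₀₁ hij)))
  have hfirst : ∀ j : Fin (x - c + 1), p' (Fin.castLE h j) = p j := fun j => dif_pos j.2
  refine ⟨⟨p', hp'⟩, ⟨?_, ?_⟩, funext hfirst⟩
  · rw [spans_forgetOrder_iff]
    obtain ⟨e, he⟩ := Set.mem_iUnion.1 hp.2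
    refine ⟨fun j => Fin.castLE h (e j), ?_⟩
    change LinearIndependent 𝕜 fun j => (p' (Fin.castLE h (e j))).rep
    simp only [hfirst]
    exact he
  -- The collinear indices are 0, 1 and the added ones x - c + 1, …, x - 1.
  · let f : Fin (c + 1) → Fin x := fun j =>
      ⟨if j.1 ≤ 1 then j.1 else x - c + j.1 - 1, by have := j.2; split_ifs <;> omega⟩
    have hf : Function.Injective f := by
      intro i j hij
      have := congrArg Fin.val hij
      simp only [f] at this
      apply Fin.ext
      split_ifs at this <;> omega
    refine ⟨Finset.univ.map ⟨p' ∘ f, hp'.comp hf⟩, fun q hq => ?_, by simp, ?_⟩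
    · obtain ⟨j, -, rfl⟩ := Finset.mem_map.1 hq
      exact (mem_forgetOrder _ _).2 ⟨_, rfl⟩
    · refine (isCollinear_iff_exists_submodule _).2 ⟨_,
        finrank_span_pair_le (p j₀).rep (p j₁).rep, fun q hq => ?_⟩
      obtain ⟨j, -, rfl⟩ := Finset.mem_map.1 (Finset.mem_coe.1 hq)
      change (p' (f j)).rep ∈ _
      by_cases hj : j.1 ≤ 1
      · have : f j = Fin.castLE h ⟨j.1, by omega⟩ := Fin.ext (if_pos hj)
        rw [this, hfirst]
        apply Submodule.subset_span
        have hj' : j.1 = 0 ∨ j.1 = 1 := by omega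
        rcases hj' with hj' | hj'
        · exact Or.inl (by simp [j₀, hj'])
        · exact Or.inr (by simp [j₁, hj'])
      · have : ¬ (f j).1 < x - c + 1 := by
          simp only [f, hj, if_false]
          omega
        rw [show p' (f j) = linePoint h₀₁ (g (f j).1) from dif_neg this]
        exact linePoint_rep_mem _ _

/-- Points of the rational normal curve satisfy the condition, by a Vandermonde determinant in three
coordinates. It is an open condition, so it is met inside any nonempty open set of the irreducible
product. -/
lemma exists_forall_independent_triple [CharZero 𝕜] {z : ℕ} (hn : 2 ≤ n)
    {U : Set (ProjPow 𝕜 n z)} (hU : IsOpen U) (hne : U.Nonempty) :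
    ∃ p ∈ U, ∀ e : Fin 3 → Fin z, Function.Injective e → p ∈ independentLocus 𝕜 n e := by
  classical
  have hG : IsOpen (⋂ (e : Fin 3 → Fin z) (_ : Function.Injective e), independentLocus 𝕜 n e) :=
    isOpen_iInter_of_finite fun e => isOpen_iInter_of_finite fun _ => isOpen_independentLocus e
  let v : Fin z → Fin (n + 1) → 𝕜 := fun i k => (i.1 : 𝕜) ^ k.1
  have hv : ∀ i, v i ≠ 0 := fun i h => by
    have := congrFun h 0
    simp [v] at this
  have hvG : mkTuple v hv ∈
      ⋂ (e : Fin 3 → Fin z) (_ : Function.Injective e), independentLocus 𝕜 n e := by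
    refine Set.mem_iInter₂.2 fun e he => ?_
    rw [mkTuple_mem_independentLocus]
    have hdet : (Matrix.vandermonde fun j => ((e j).1 : 𝕜)).det ≠ 0 :=
      Matrix.det_vandermonde_ne_zero_iff.2 (Nat.cast_injective.comp (Fin.val_injective.comp he))
    refine LinearIndependent.of_comp
      (LinearMap.funLeft 𝕜 𝕜 (Fin.castLE (by omega : 3 ≤ n + 1))) ?_
    exact Matrix.linearIndependent_rows_of_det_ne_zero hdet
  obtain ⟨u, hu⟩ := hne
  obtain ⟨p, -, hpU, hpG⟩ := isPreirreducible_univ_projPow _ _ hU hG ⟨u, trivial, hu⟩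
    ⟨_, trivial, hvG⟩
  exact ⟨p, hpU, fun e he => Set.mem_iInter₂.1 hpG e he⟩

lemma le_of_subset_image_firstFactors [CharZero 𝕜] {c z : ℕ} (hn : 2 ≤ n) (hcx : c ≤ x)
    (h : z ≤ x) {U : Set (ProjPow 𝕜 n z)} (hU : IsOpen U) (hne : U.Nonempty)
    (hsub : U ⊆ firstFactors h '' (forgetOrder ⁻¹' collinearLocus 𝕜 n x c)) :
    z ≤ x - c + 1 := by
  classical
  by_contra! hz
  obtain ⟨q, hq, hind⟩ := exists_forall_independent_triple hn hU hne
  obtain ⟨p, ⟨-, A, hA, hcard, hcol⟩, rfl⟩ := hsub hq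
  let I : Finset (Fin z) := Finset.univ.filter fun i => p.1 (Fin.castLE h i) ∈ A
  -- At most x - z ≤ c - 2 of the c + 1 collinear points lie outside the first `z` positions.
  have hI : 2 < I.card := by
    have h1 : A ⊆ I.image (fun i => p.1 (Fin.castLE h i)) ∪
        (Finset.univ.image fun j : Fin (x - z) => p.1 ⟨z + j.1, by omega⟩) := by
      intro a ha
      obtain ⟨i, rfl⟩ := (mem_forgetOrder _ _).1 (hA ha)
      by_cases hi : i.1 < z
      · refine Finset.mem_union_left _ (Finset.mem_image.2 ⟨⟨i.1, hi⟩, ?_, rfl⟩)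
        exact Finset.mem_filter.2 ⟨Finset.mem_univ _, ha⟩
      · refine Finset.mem_union_right _ (Finset.mem_image.2 ⟨⟨i.1 - z, by omega⟩,
          Finset.mem_univ _, ?_⟩)
        exact congrArg (fun i => p.1 i) (Fin.ext (by dsimp only; omega))
    have h2 := (Finset.card_le_card h1).trans (Finset.card_union_le _ _)
    have h3 : (I.image (fun i => p.1 (Fin.castLE h i))).card ≤ I.card := Finset.card_image_le
    have h4 : (Finset.univ.image fun j : Fin (x - z) => p.1 ⟨z + j.1, by omega⟩).card ≤ x - z :=
      Finset.card_image_le.trans (by simp)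
    omega
  obtain ⟨i, j, k, hi, hj, hk, hij, hik, hjk⟩ := Finset.two_lt_card_iff.1 hI
  have he : Function.Injective (![i, j, k] : Fin 3 → Fin z) := by
    intro a b hab
    fin_cases a <;> fin_cases b <;> simp_all
  refine not_linearIndependent_of_isCollinear hcol (fun l => ?_) (hind _ he)
  have : ∀ m ∈ I, firstFactors h p m ∈ A := fun m hm => (Finset.mem_filter.1 hm).2
  fin_cases l
  · exact this i hi
  · exact this j hj
  · exact this k hk

theorem hasSpread_collinearLocus [CharZero 𝕜] {c : ℕ} (hn : 2 ≤ n) (hc : 1 ≤ c)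
    (hcx : n + c ≤ x) : HasSpread (collinearLocus 𝕜 n x c) (x - c + 1) :=
  ⟨⟨by omega, _, isOpen_spanningTuples, nonempty_spanningTuples (by omega) (by omega),
    spanningTuples_subset_image_firstFactors (by omega) _⟩,
    fun _ ⟨h, _, hU, hne, hsub⟩ => le_of_subset_image_firstFactors hn (by omega) h hU hne hsub⟩

end Spread

/-! ### Forms on a line, the jet obstruction, and positivity of h⁰. -/

section DoublePoints

variable {𝕜 : Type*} [Field 𝕜] {n : ℕ}

/-- `F` vanishes at the point with homogeneous coordinates `v`, together with its first partial
derivatives. -/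
def IsSingularAt (F : CoordRing 𝕜 n) (v : Fin (n + 1) → 𝕜) : Prop :=
  MvPolynomial.eval v F = 0 ∧ ∀ j, MvPolynomial.eval v (MvPolynomial.pderiv j F) = 0

lemma mem_doubleForms {A : Set (PSpace 𝕜 n)} {m : ℕ} {F : CoordRing 𝕜 n} :
    F ∈ doubleForms A m ↔ F.IsHomogeneous m ∧ ∀ p ∈ A, IsSingularAt F p.rep := Iff.rfl

lemma IsSingularAt.sub {F G : CoordRing 𝕜 n} {v : Fin (n + 1) → 𝕜} (hF : IsSingularAt F v)
    (hG : IsSingularAt G v) : IsSingularAt (F - G) v := by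
  simp [IsSingularAt, hF.1, hF.2, hG.1, hG.2]

lemma IsSingularAt.mul_right {F : CoordRing 𝕜 n} {v : Fin (n + 1) → 𝕜} (hF : IsSingularAt F v)
    (G : CoordRing 𝕜 n) : IsSingularAt (F * G) v := by
  simp [IsSingularAt, hF.1, hF.2, Derivation.leibniz]

lemma isSingularAt_mul {F G : CoordRing 𝕜 n} {v : Fin (n + 1) → 𝕜}
    (hF : MvPolynomial.eval v F = 0) (hG : MvPolynomial.eval v G = 0) :
    IsSingularAt (F * G) v := by
  simp [IsSingularAt, hF, hG, Derivation.leibniz]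

lemma IsSingularAt.of_mul {F G : CoordRing 𝕜 n} {v : Fin (n + 1) → 𝕜}
    (h : IsSingularAt (F * G) v) (hG : MvPolynomial.eval v G ≠ 0) : IsSingularAt F v := by
  have h0 : MvPolynomial.eval v F = 0 := by
    have := h.1
    rw [map_mul] at this
    exact (mul_eq_zero.1 this).resolve_right hG
  refine ⟨h0, fun j => ?_⟩
  have := h.2 j
  rw [Derivation.leibniz, smul_eq_mul, smul_eq_mul, map_add, map_mul, map_mul, h0, zero_mul,
    zero_add] at this
  exact (mul_eq_zero.1 this).resolve_left hG

lemma eval_smul_of_isHomogeneous {F : CoordRing 𝕜 n} {m : ℕ} (hF : F.IsHomogeneous m) (l : 𝕜)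
    (v : Fin (n + 1) → 𝕜) :
    MvPolynomial.eval (l • v) F = l ^ m * MvPolynomial.eval v F := by
  rw [MvPolynomial.eval_eq', MvPolynomial.eval_eq', Finset.mul_sum]
  refine Finset.sum_congr rfl fun d hd => ?_
  have hm : ∑ i, d i = m := by
    by_contra hne
    refine MvPolynomial.mem_support_iff.1 hd (hF.coeff_eq_zero ?_)
    rwa [Finsupp.degree_eq_sum]
  simp only [Pi.smul_apply, smul_eq_mul, mul_pow]
  rw [Finset.prod_mul_distrib, Finset.prod_pow_eq_pow_sum, hm]
  ring

lemma IsSingularAt.smul {F : CoordRing 𝕜 n} {m : ℕ} (hF : F.IsHomogeneous m)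
    {v : Fin (n + 1) → 𝕜} (h : IsSingularAt F v) (l : 𝕜) : IsSingularAt F (l • v) := by
  refine ⟨by rw [eval_smul_of_isHomogeneous hF, h.1, mul_zero], fun j => ?_⟩
  rw [eval_smul_of_isHomogeneous hF.pderiv, h.2 j, mul_zero]

/-- Euler's identity at a point. -/
lemma sum_mul_eval_pderiv {F : CoordRing 𝕜 n} {m : ℕ} (hF : F.IsHomogeneous m)
    (v : Fin (n + 1) → 𝕜) :
    ∑ j, v j * MvPolynomial.eval v (MvPolynomial.pderiv j F) = m * MvPolynomial.eval v F := by
  have := congrArg (MvPolynomial.eval v) hF.sum_X_mul_pderiv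
  simpa using this

/-- The restriction of `F` to the line `T ↦ v + T q`. -/
def restrictLine (F : CoordRing 𝕜 n) (v q : Fin (n + 1) → 𝕜) : Polynomial 𝕜 :=
  MvPolynomial.aeval (fun j => Polynomial.C (v j) + Polynomial.X * Polynomial.C (q j)) F

lemma eval_restrictLine (F : CoordRing 𝕜 n) (v q : Fin (n + 1) → 𝕜) (t : 𝕜) :
    (restrictLine F v q).eval t = MvPolynomial.eval (v + t • q) F := by
  rw [restrictLine, ← Polynomial.coe_evalRingHom, MvPolynomial.aeval_def, MvPolynomial.hom_eval₂,
    MvPolynomial.eval, MvPolynomial.coe_eval₂Hom]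
  congr 1
  · ext
    simp
  · funext j
    simp only [Polynomial.coe_evalRingHom, Polynomial.eval_add, Polynomial.eval_C,
      Polynomial.eval_mul, Polynomial.eval_X, Pi.add_apply, Pi.smul_apply, smul_eq_mul]

lemma natDegree_restrictLine_le {F : CoordRing 𝕜 n} {m : ℕ} (hF : F.IsHomogeneous m)
    (v q : Fin (n + 1) → 𝕜) : (restrictLine F v q).natDegree ≤ m := by
  have := MvPolynomial.aeval_natDegree_le F hF.totalDegree_le
    (fun j => Polynomial.C (v j) + Polynomial.X * Polynomial.C (q j)) (n := 1) fun j => by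
      refine (Polynomial.natDegree_add_le _ _).trans (max_le (by simp) ?_)
      refine Polynomial.natDegree_mul_le.trans ?_
      rw [Polynomial.natDegree_C, add_zero]
      exact Polynomial.natDegree_X_le
  rwa [mul_one] at this

lemma derivative_restrictLine (F : CoordRing 𝕜 n) (v q : Fin (n + 1) → 𝕜) :
    Polynomial.derivative (restrictLine F v q) =
      ∑ j, restrictLine (MvPolynomial.pderiv j F) v q * Polynomial.C (q j) := by
  induction F using MvPolynomial.induction_on with
  | C a => simp [restrictLine]
  | add F G hF hG =>
    have h : ∀ F G : CoordRing 𝕜 n, restrictLine (F + G) v q =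
      restrictLine F v q + restrictLine G v q := fun F G => map_add _ _ _
    simp only [h, map_add, hF, hG, add_mul, Finset.sum_add_distrib]
  | mul_X F i hF =>
    have h : ∀ F G : CoordRing 𝕜 n, restrictLine (F * G) v q =
      restrictLine F v q * restrictLine G v q := fun F G => map_mul _ _ _
    have h' : ∀ F G : CoordRing 𝕜 n, restrictLine (F + G) v q =
      restrictLine F v q + restrictLine G v q := fun F G => map_add _ _ _
    have hX : restrictLine (MvPolynomial.X i : CoordRing 𝕜 n) v q =
      Polynomial.C (v i) + Polynomial.X * Polynomial.C (q i) := MvPolynomial.aeval_X _ _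
    have hs : ∀ j, restrictLine (MvPolynomial.pderiv j (MvPolynomial.X i : CoordRing 𝕜 n)) v q =
        if i = j then 1 else 0 := fun j => by
      rw [MvPolynomial.pderiv_X, Pi.single_apply]
      split_ifs
      · exact map_one _
      · exact map_zero _
    simp only [h, h', Polynomial.derivative_mul, hF, Derivation.leibniz, smul_eq_mul, hs, hX,
      add_mul, Finset.sum_add_distrib, Polynomial.derivative_add, Polynomial.derivative_C,
      Polynomial.derivative_X, one_mul, zero_add, mul_zero, add_zero]
    rw [Finset.sum_mul, add_comm]
    congr 1
    · simp
    · rw [← Finset.sum_add_distrib]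
      exact Finset.sum_congr rfl fun j _ => by ring

/-- A form of degree `d` that is singular at `c` of `c + 1` collinear points, `d ≤ 2c`, and
vanishes at the remaining point has zero derivative there in the direction of the line. -/
lemma sum_mul_eval_pderiv_eq_zero {d c : ℕ} (hdc : d ≤ 2 * c) {Q : CoordRing 𝕜 n}
    (hQ : Q.IsHomogeneous d) {A : Finset (PSpace 𝕜 n)} (hA : A.card = c + 1) {p₀ : PSpace 𝕜 n}
    (hp₀ : p₀ ∈ A) (q : Fin (n + 1) → 𝕜) (t m : PSpace 𝕜 n → 𝕜)
    (ht : ∀ p ∈ A, m p • p.rep = p₀.rep + t p • q) (htinj : Set.InjOn t A) (ht₀ : t p₀ = 0)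
    (hsing : ∀ p ∈ A, p ≠ p₀ → IsSingularAt Q p.rep) (h₀ : MvPolynomial.eval p₀.rep Q = 0) :
    ∑ j, q j * MvPolynomial.eval p₀.rep (MvPolynomial.pderiv j Q) = 0 := by
  classical
  by_contra hne
  let f := restrictLine Q p₀.rep q
  have hder : ∀ s, (Polynomial.derivative f).eval s =
      ∑ j, q j * MvPolynomial.eval (p₀.rep + s • q) (MvPolynomial.pderiv j Q) := fun s => by
    rw [derivative_restrictLine, Polynomial.eval_finsetSum]
    refine Finset.sum_congr rfl fun j _ => ?_
    rw [Polynomial.eval_mul, eval_restrictLine, Polynomial.eval_C, mul_comm]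
  have hf : f ≠ 0 := fun hf => hne (by
    have := hder 0
    rw [hf] at this
    simpa using this.symm)
  have hdeg : f.natDegree ≤ d := natDegree_restrictLine_le hQ _ _
  -- The product has degree 2c + 1: a double zero at each singular point and a simple one at `p₀`.
  -- This exceeds the degree of `f`, although `f` is nonzero by assumption.
  have hdvd : ∏ p ∈ A, (Polynomial.X - Polynomial.C (t p)) ^ (if p = p₀ then 1 else 2) ∣ f := by
    refine Finset.prod_dvd_of_coprime (fun p hp p' hp' hpp => ?_) fun p hp => ?_
    · exact (Polynomial.isCoprime_X_sub_C_of_isUnit_sub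
        (sub_ne_zero.2 fun h => hpp (htinj hp hp' h)).isUnit).pow
    · rw [← Polynomial.le_rootMultiplicity_iff hf]
      split_ifs with h
      · rw [Nat.one_le_iff_ne_zero, ← Nat.pos_iff_ne_zero, Polynomial.rootMultiplicity_pos hf,
          Polynomial.IsRoot, eval_restrictLine, h, ht₀, zero_smul, add_zero, h₀]
      · have hs := (hsing p hp h).smul hQ (m p)
        rw [ht p hp] at hs
        refine (Polynomial.one_lt_rootMultiplicity_iff_isRoot hf).2 ⟨?_, ?_⟩
        · rw [Polynomial.IsRoot, eval_restrictLine, hs.1]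
        · rw [Polynomial.IsRoot, hder]
          exact Finset.sum_eq_zero fun j _ => by rw [hs.2 j, mul_zero]
  have h1 := Polynomial.natDegree_le_of_dvd hdvd hf
  rw [Polynomial.natDegree_prod _ _ fun p _ => pow_ne_zero _ (Polynomial.X_sub_C_ne_zero _)] at h1
  simp only [Polynomial.natDegree_pow, Polynomial.natDegree_X_sub_C, mul_one] at h1
  rw [← Finset.add_sum_erase _ _ hp₀, if_pos rfl, Finset.sum_congr rfl (g := fun _ => 2)
    fun p hp => if_neg (Finset.ne_of_mem_erase hp), Finset.sum_const,
    Finset.card_erase_of_mem hp₀, hA] at h1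
  simp only [smul_eq_mul] at h1
  omega

/-- A linear functional `φ` nonzero on all points of `A` puts them in one affine chart. Rescaled to
the value `φ p₀.rep`, their representatives differ from `p₀.rep` by multiples of one vector in the
kernel of `φ`. -/
lemma exists_line_parametrization [Infinite 𝕜] {A : Finset (PSpace 𝕜 n)} (hA : 2 ≤ A.card)
    (hcol : Projectivization.IsCollinear (A : Set (PSpace 𝕜 n))) :
    ∃ p₀ ∈ A, ∃ (q : Fin (n + 1) → 𝕜) (t m : PSpace 𝕜 n → 𝕜),
      LinearIndependent 𝕜 ![p₀.rep, q] ∧ (∀ p ∈ A, m p ≠ 0 ∧ m p • p.rep = p₀.rep + t p • q) ∧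
        t p₀ = 0 := by
  obtain ⟨p₀, hp₀, p₁, hp₁, h₀₁⟩ := Finset.one_lt_card.1 hA
  obtain ⟨φ, hφ⟩ := Module.exists_dual_forall_apply_ne_zero (K := 𝕜)
    (fun p : A => p.1.rep) fun p => p.1.rep_nonzero
  have hφ' : ∀ p ∈ A, φ p.rep ≠ 0 := fun p hp => hφ ⟨p, hp⟩
  have hli : LinearIndependent 𝕜 ![p₀.rep, p₁.rep] :=
    Projectivization.linearIndependent_pair_iff_ne.2 h₀₁
  let r := φ p₀.rep / φ p₁.rep
  have hr : r ≠ 0 := div_ne_zero (hφ' _ hp₀) (hφ' _ hp₁)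
  have hex : ∀ p ∈ A, ∃ s : 𝕜,
      (φ p₀.rep / φ p.rep) • p.rep = p₀.rep + s • (r • p₁.rep - p₀.rep) := by
    intro p hp
    have hnot := not_linearIndependent_of_isCollinear hcol (v := ![p₀, p₁, p]) (by
      intro l
      fin_cases l
      · exact hp₀
      · exact hp₁
      · exact hp)
    have he : (fun i => ((![p₀, p₁, p] : Fin 3 → PSpace 𝕜 n) i).rep) =
        ![p₀.rep, p₁.rep, p.rep] := by
      funext l
      fin_cases l <;> rfl
    rw [he] at hnot
    obtain ⟨a, b, hab⟩ := mem_span_pair_of_not_linearIndependent hli hnot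
    have hφp : φ p.rep = a * φ p₀.rep + b * φ p₁.rep := by
      conv_lhs => rw [hab]
      simp
    have h1 := hφ' _ hp₀
    have h2 := hφ' _ hp₁
    have h3 := hφ' _ hp
    refine ⟨b * φ p₁.rep / φ p.rep, ?_⟩
    rw [show (φ p₀.rep / φ p.rep) • p.rep =
      (φ p₀.rep / φ p.rep) • (a • p₀.rep + b • p₁.rep) from congrArg _ hab]
    rw [smul_add, smul_smul, smul_smul, smul_sub, smul_smul]
    have ha : φ p₀.rep / φ p.rep * a = 1 - b * φ p₁.rep / φ p.rep := by
      field_simp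
      rw [hφp]
      ring
    have hb : φ p₀.rep / φ p.rep * b = b * φ p₁.rep / φ p.rep * r := by
      simp only [r]
      field_simp
    rw [ha, hb, sub_smul, one_smul]
    abel
  choose! s hs using hex
  have hq : LinearIndependent 𝕜 ![p₀.rep, r • p₁.rep - p₀.rep] := by
    rw [LinearIndependent.pair_iff] at hli ⊢
    intro a b hab
    have := hli (a - b) (b * r) (by
      rw [← hab, smul_sub, smul_smul, sub_smul]
      abel)
    have hb : b = 0 := (mul_eq_zero.1 this.2).resolve_right hr
    exact ⟨by rw [← sub_eq_zero.1 (by simpa [hb] using this.1 : a - 0 = 0)], hb⟩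
  refine ⟨p₀, hp₀, r • p₁.rep - p₀.rep, s, fun p => φ p₀.rep / φ p.rep, hq, fun p hp =>
    ⟨div_ne_zero (hφ' _ hp₀) (hφ' _ hp), hs p hp⟩, ?_⟩
  have := hs p₀ hp₀
  rw [div_self (hφ' _ hp₀), one_smul, left_eq_add] at this
  refine (smul_eq_zero.1 this).resolve_right ?_
  exact hq.ne_zero 1

/-- Supplies both the obstructing jet and the linear forms that vanish at one point but not at
another. -/
lemma exists_dual_vector {u v : Fin (n + 1) → 𝕜} (h : LinearIndependent 𝕜 ![u, v]) :
    ∃ w : Fin (n + 1) → 𝕜, ∑ j, u j * w j = 0 ∧ ∑ j, v j * w j = 1 := by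
  obtain ⟨g, hg⟩ := LinearMap.exists_leftInverse_of_injective (Fintype.linearCombination 𝕜 ![u, v])
    (LinearMap.ker_eq_bot.2 h.fintypeLinearCombination_injective)
  have key : ∀ a : Fin (n + 1) → 𝕜, ∑ j, a j * g (Pi.single j 1) 1 = g a 1 := fun a => by
    rw [LinearMap.pi_apply_eq_sum_univ g a, Finset.sum_apply]
    refine Finset.sum_congr rfl fun j _ => ?_
    have he : (fun i => if j = i then (1 : 𝕜) else 0) = Pi.single j 1 := by
      funext i
      simp [Pi.single_apply, eq_comm]
    rw [Pi.smul_apply, smul_eq_mul, he]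
  refine ⟨fun j => g (Pi.single j 1) 1, ?_, ?_⟩
  · rw [key]
    have := congrFun (LinearMap.congr_fun hg (Pi.single 0 1)) 1
    simpa using this
  · rw [key]
    have := congrFun (LinearMap.congr_fun hg (Pi.single 1 1)) 1
    simpa using this

/-- A first-order condition at a point `p₀` of a set `S` with `c + 1` collinear points that is not
satisfied by any form of degree `d ≤ 2c` that is singular at the other points. -/
lemma exists_jet_obstruction [Infinite 𝕜] {d c : ℕ} (hc : 1 ≤ c) (hdc : d ≤ 2 * c)
    {S : Finset (PSpace 𝕜 n)} (hS : ContainsCollinear S (c + 1)) :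
    ∃ p₀ ∈ S, ∃ w : Fin (n + 1) → 𝕜, ∑ j, p₀.rep j * w j = 0 ∧
      ∀ Q : CoordRing 𝕜 n, Q.IsHomogeneous d → (∀ p ∈ S, p ≠ p₀ → IsSingularAt Q p.rep) →
        MvPolynomial.eval p₀.rep Q = 0 →
          ¬ ∀ j, MvPolynomial.eval p₀.rep (MvPolynomial.pderiv j Q) = w j := by
  obtain ⟨A, hAS, hA, hcol⟩ := hS
  obtain ⟨p₀, hp₀, q, t, m, hli, ht, ht₀⟩ := exists_line_parametrization (by omega) hcol
  -- `w` kills `p₀`, as Euler's identity requires of the gradient of a form vanishing there, but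
  -- pairs to 1 with the line direction `q`, where the derivative is forced to be 0.
  obtain ⟨w, hw₀, hw₁⟩ := exists_dual_vector hli
  refine ⟨p₀, hAS hp₀, w, hw₀, fun Q hQ hsing hQ₀ hQw => ?_⟩
  have hinj : Set.InjOn t A := by
    intro p hp p' hp' h
    have h1 : m p • p.rep = m p' • p'.rep := by rw [(ht p hp).2, (ht p' hp').2, h]
    rw [← p.mk_rep, ← p'.mk_rep, Projectivization.mk_eq_mk_iff']
    refine ⟨(m p)⁻¹ * m p', ?_⟩
    rw [mul_smul, ← h1, inv_smul_smul₀ (ht p hp).1]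
  have := sum_mul_eval_pderiv_eq_zero hdc hQ hA hp₀ q t m (fun p hp => (ht p hp).2) hinj ht₀
    (fun p hp => hsing p (hAS hp)) hQ₀
  simp only [hQw, hw₁] at this
  exact one_ne_zero this

lemma choose_le_finrank_homogeneousSubmodule (d : ℕ) :
    (n + d).choose n ≤ Module.finrank 𝕜 (MvPolynomial.homogeneousSubmodule (Fin (n + 1)) 𝕜 d) := by
  classical
  have : Module.Finite 𝕜 (MvPolynomial.homogeneousSubmodule (Fin (n + 1)) 𝕜 d) :=
    Module.Finite.iff_fg.2 (MvPolynomial.homogeneousSubmodule_fg _ _ d)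
  let b : (Finset.univ : Finset (Fin (n + 1))).finsuppAntidiag d →
      MvPolynomial.homogeneousSubmodule (Fin (n + 1)) 𝕜 d := fun m =>
    ⟨MvPolynomial.monomial m.1 1, MvPolynomial.isHomogeneous_monomial _ (by
      have := (Finset.mem_finsuppAntidiag.1 m.2).1
      rw [Finsupp.degree_eq_sum]
      exact this)⟩
  have hb : LinearIndependent 𝕜 b := by
    refine LinearIndependent.of_comp (Submodule.subtype _) ?_
    have := (MvPolynomial.basisMonomials (Fin (n + 1)) 𝕜).linearIndependent.comp
      (fun m : (Finset.univ : Finset (Fin (n + 1))).finsuppAntidiag d => m.1) Subtype.val_injective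
    have he : (Submodule.subtype _ ∘ b) = (MvPolynomial.basisMonomials (Fin (n + 1)) 𝕜) ∘
        (fun m : (Finset.univ : Finset (Fin (n + 1))).finsuppAntidiag d => m.1) := by
      funext m
      simp [b]
    rw [he]
    exact this
  have h := hb.fintype_card_le_finrank
  rw [Fintype.card_coe, Finset.card_finsuppAntidiag_nat_eq_choose] at h
  simp only [Finset.card_univ, Fintype.card_fin] at h
  rw [show n + 1 + d - 1 = n + d by omega, ← Nat.choose_symm_add] at h
  exact h

/-- The map `G` of gradients at the points of `S` misses the obstructing jet, so by the dimension
count it has a kernel. -/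
theorem h0_pos_of_containsCollinear [CharZero 𝕜] {d c : ℕ} (hd : d ≠ 0) (hc : 1 ≤ c)
    (hdc : d ≤ 2 * c) {S : Finset (PSpace 𝕜 n)} (hS : ContainsCollinear S (c + 1))
    (hcard : (n + 1) * S.card ≤ (n + d).choose n) : 0 < h0 S d := by
  classical
  obtain ⟨p₀, hp₀, w, hw, hobs⟩ := exists_jet_obstruction hc hdc hS
  have hd' : (d : 𝕜) ≠ 0 := Nat.cast_ne_zero.2 hd
  let G : MvPolynomial.homogeneousSubmodule (Fin (n + 1)) 𝕜 d →ₗ[𝕜] (S → Fin (n + 1) → 𝕜) :=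
    { toFun := fun F p j => MvPolynomial.eval p.1.rep (MvPolynomial.pderiv j F.1)
      map_add' := fun F F' => by
        funext p j
        simp
      map_smul' := fun a F => by
        funext p j
        simp }
  -- In characteristic zero Euler's identity recovers the vanishing of `F` from its gradient, so
  -- gradients alone record the double point conditions.
  have heuler : ∀ F : MvPolynomial.homogeneousSubmodule (Fin (n + 1)) 𝕜 d, ∀ v,
      ∑ j, v j * MvPolynomial.eval v (MvPolynomial.pderiv j F.1) = 0 →
        MvPolynomial.eval v F.1 = 0 := fun F v h => by
    rw [sum_mul_eval_pderiv F.2] at h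
    exact (mul_eq_zero.1 h).resolve_left hd'
  have hG : ¬ Function.Surjective G := by
    intro hG
    obtain ⟨F, hF⟩ := hG fun p => if p.1 = p₀ then w else 0
    have hF' : ∀ p ∈ S, ∀ j, MvPolynomial.eval p.rep (MvPolynomial.pderiv j F.1) =
        (if p = p₀ then w else 0) j := fun p hp j => congrFun (congrFun hF ⟨p, hp⟩) j
    refine hobs F.1 F.2 (fun p hp hpp => ?_) ?_ fun j => ?_
    · have h : ∀ j, MvPolynomial.eval p.rep (MvPolynomial.pderiv j F.1) = 0 := fun j => by
        rw [hF' p hp, if_neg hpp]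
        rfl
      exact ⟨heuler F _ (Finset.sum_eq_zero fun j _ => by rw [h j, mul_zero]), h⟩
    · refine heuler F _ ?_
      rw [← hw]
      exact Finset.sum_congr rfl fun j _ => by rw [hF' p₀ hp₀, if_pos rfl]
    · rw [hF' p₀ hp₀, if_pos rfl]
  have : Module.Finite 𝕜 (MvPolynomial.homogeneousSubmodule (Fin (n + 1)) 𝕜 d) :=
    Module.Finite.iff_fg.2 (MvPolynomial.homogeneousSubmodule_fg _ _ d)
  have hker : ¬ Function.Injective G := by
    intro hinj
    apply hG
    rw [← LinearMap.range_eq_top]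
    apply Submodule.eq_top_of_finrank_eq
    refine le_antisymm (Submodule.finrank_le _) ?_
    rw [LinearMap.finrank_range_of_inj hinj]
    refine le_trans ?_ (choose_le_finrank_homogeneousSubmodule d)
    rw [Module.finrank_pi_fintype]
    simpa [mul_comm] using hcard
  rw [← LinearMap.ker_eq_bot, Submodule.eq_bot_iff] at hker
  push Not at hker
  obtain ⟨F, hF, hF0⟩ := hker
  have hF' : ∀ p ∈ S, ∀ j, MvPolynomial.eval p.rep (MvPolynomial.pderiv j F.1) = 0 :=
    fun p hp j => congrFun (congrFun hF ⟨p, hp⟩) j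
  have hmem : F.1 ∈ doubleForms (S : Set (PSpace 𝕜 n)) d := mem_doubleForms.2 ⟨F.2, fun p hp =>
    ⟨heuler F _ (Finset.sum_eq_zero fun j _ => by rw [hF' p hp j, mul_zero]), hF' p hp⟩⟩
  rw [h0, rank_pos_iff_nontrivial]
  refine ⟨⟨F.1, hmem⟩, 0, fun h => hF0 (Subtype.ext ?_)⟩
  exact (congrArg Subtype.val h :)

end DoublePoints

/-! ### Positivity of h¹ by a Čech cocycle. -/

section Cohomology

variable {𝕜 : Type*} [Field 𝕜] {n : ℕ}

/-- The linear form with coefficients `w`. -/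
def linearForm (w : Fin (n + 1) → 𝕜) : CoordRing 𝕜 n :=
  ∑ j, MvPolynomial.X j * MvPolynomial.C (w j)

lemma isHomogeneous_linearForm (w : Fin (n + 1) → 𝕜) : (linearForm w).IsHomogeneous 1 :=
  MvPolynomial.IsHomogeneous.sum _ _ _ fun j _ =>
    (MvPolynomial.isHomogeneous_X 𝕜 j).mul (MvPolynomial.isHomogeneous_C _ (w j))

lemma eval_linearForm (w v : Fin (n + 1) → 𝕜) :
    MvPolynomial.eval v (linearForm w) = ∑ j, v j * w j := by
  simp [linearForm]

lemma pderiv_linearForm (w : Fin (n + 1) → 𝕜) (j : Fin (n + 1)) :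
    MvPolynomial.pderiv j (linearForm w) = MvPolynomial.C (w j) := by
  classical
  simp [linearForm, Derivation.leibniz, MvPolynomial.pderiv_X, Pi.single_apply]

lemma exists_form_eq_zero_ne_zero (S : Finset (PSpace 𝕜 n)) {p₀ : PSpace 𝕜 n} (hp₀ : p₀ ∉ S) :
    ∃ (e : ℕ) (H : CoordRing 𝕜 n), H.IsHomogeneous e ∧ MvPolynomial.eval p₀.rep H ≠ 0 ∧
      ∀ p ∈ S, MvPolynomial.eval p.rep H = 0 := by
  classical
  induction S using Finset.induction_on with
  | empty => exact ⟨0, 1, MvPolynomial.isHomogeneous_one _ _, by simp, by simp⟩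
  | insert p S _ ih =>
    rw [Finset.mem_insert, not_or] at hp₀
    obtain ⟨e, H, hH, hH₀, hHS⟩ := ih hp₀.2
    obtain ⟨w, hw, hw₀⟩ := exists_dual_vector
      (Projectivization.linearIndependent_pair_iff_ne.2 (Ne.symm hp₀.1))
    refine ⟨1 + e, linearForm w * H, (isHomogeneous_linearForm w).mul hH, ?_, fun p' hp' => ?_⟩
    · rwa [map_mul, eval_linearForm, hw₀, one_mul]
    · rw [map_mul]
      rcases Finset.mem_insert.1 hp' with rfl | h
      · rw [eval_linearForm, hw, zero_mul]
      · rw [hHS p' h, mul_zero]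

/-- A form of some degree, singular at all points of `S` other than `p₀`, with a prescribed
first-order jet at `p₀`. -/
lemma exists_form_with_jet (S : Finset (PSpace 𝕜 n)) (p₀ : PSpace 𝕜 n) {w : Fin (n + 1) → 𝕜}
    (hw : ∑ j, p₀.rep j * w j = 0) :
    ∃ (N : ℕ) (T : CoordRing 𝕜 n), T.IsHomogeneous N ∧
      (∀ p ∈ S, p ≠ p₀ → IsSingularAt T p.rep) ∧ MvPolynomial.eval p₀.rep T = 0 ∧
        ∀ j, MvPolynomial.eval p₀.rep (MvPolynomial.pderiv j T) = w j := by
  classical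
  obtain ⟨e, H, hH, hH₀, hHS⟩ := exists_form_eq_zero_ne_zero (S.erase p₀) (Finset.notMem_erase p₀ S)
  let a := MvPolynomial.eval p₀.rep H
  -- The square of `H` makes the form singular away from `p₀`. At `p₀` the linear form vanishes, so
  -- only its gradient `w` survives, multiplied by `a * a` and then normalized.
  refine ⟨e + e + (1 + 0), H * H * (linearForm w * MvPolynomial.C ((a * a)⁻¹)),
    (hH.mul hH).mul ((isHomogeneous_linearForm w).mul (MvPolynomial.isHomogeneous_C _ _)),
    fun p hp hpp => ?_, ?_, fun j => ?_⟩
  · have h := hHS p (Finset.mem_erase.2 ⟨hpp, hp⟩)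
    exact (isSingularAt_mul h h).mul_right _
  · simp [eval_linearForm, hw]
  · have ha : MvPolynomial.eval p₀.rep H = a := rfl
    have ha0 : a ≠ 0 := hH₀
    simp only [Derivation.leibniz, smul_eq_mul, map_add, map_mul, eval_linearForm, hw,
      pderiv_linearForm, MvPolynomial.pderiv_C, MvPolynomial.eval_C, map_zero, ha]
    field_simp
    ring

lemma isHomogeneous_of_mul_X_pow {Q : CoordRing 𝕜 n} {i : Fin (n + 1)} {a m : ℕ}
    (h : (Q * MvPolynomial.X i ^ a).IsHomogeneous (m + a)) : Q.IsHomogeneous m := by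
  intro s hs
  have h1 := @h (s + Finsupp.single i a) (by
    rwa [MvPolynomial.X_pow_eq_monomial, MvPolynomial.coeff_mul_monomial, mul_one])
  rw [map_add, Finsupp.weight_single] at h1
  simpa using h1

/-- A fraction with a power of `X i` as denominator and also a power of `X j` is a polynomial, these
primes being coprime. This is the gluing of sections to a global form. -/
lemma exists_eq_algebraMap {r : FractionRing (CoordRing 𝕜 n)} {i j : Fin (n + 1)} (hij : i ≠ j)
    {a b : ℕ} {P P' : CoordRing 𝕜 n}
    (hi : r * algebraMap _ _ (MvPolynomial.X i ^ a : CoordRing 𝕜 n) = algebraMap _ _ P)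
    (hj : r * algebraMap _ _ (MvPolynomial.X j ^ b : CoordRing 𝕜 n) = algebraMap _ _ P') :
    ∃ Q : CoordRing 𝕜 n, r = algebraMap _ _ Q := by
  have hinj := IsFractionRing.injective (CoordRing 𝕜 n) (FractionRing (CoordRing 𝕜 n))
  have h : P * MvPolynomial.X j ^ b = P' * MvPolynomial.X i ^ a := by
    apply hinj
    rw [map_mul, map_mul, ← hi, ← hj]
    ring
  have hdvd : (MvPolynomial.X i : CoordRing 𝕜 n) ^ a ∣ P := by
    refine MvPolynomial.X_prime.pow_dvd_of_dvd_mul_right a (fun h' => hij ?_)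
      ⟨P', h.trans (mul_comm _ _)⟩
    exact MvPolynomial.X_dvd_X.1 (MvPolynomial.X_prime.dvd_of_dvd_pow h')
  obtain ⟨Q, rfl⟩ := hdvd
  refine ⟨Q, ?_⟩
  have hne : algebraMap _ (FractionRing (CoordRing 𝕜 n))
      (MvPolynomial.X i ^ a : CoordRing 𝕜 n) ≠ 0 :=
    (map_ne_zero_iff _ hinj).2 (pow_ne_zero _ (MvPolynomial.X_ne_zero i))
  apply mul_right_cancel₀ hne
  rw [hi, map_mul, mul_comm]

/-- If a first-order condition at `p₀ ∈ S` is not satisfied by any form of degree `d` that is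
singular at the other points of `S`, then `h¹(𝓘_{2S}(d)) > 0`. -/
theorem h1_pos_of_jet_obstruction (hn : 1 ≤ n) {d : ℕ} {S : Finset (PSpace 𝕜 n)} {p₀ : PSpace 𝕜 n}
    (hp₀ : p₀ ∈ S) {w : Fin (n + 1) → 𝕜} (hw : ∑ j, p₀.rep j * w j = 0)
    (hobs : ∀ Q : CoordRing 𝕜 n, Q.IsHomogeneous d →
      (∀ p ∈ S, p ≠ p₀ → IsSingularAt Q p.rep) → MvPolynomial.eval p₀.rep Q = 0 →
        ¬ ∀ j, MvPolynomial.eval p₀.rep (MvPolynomial.pderiv j Q) = w j) : 0 < h1 S d := by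
  classical
  obtain ⟨N, T, hT, hTS, hT₀, hTw⟩ := exists_form_with_jet S p₀ hw
  let A := algebraMap (CoordRing 𝕜 n) (FractionRing (CoordRing 𝕜 n))
  have hinj : Function.Injective A := IsFractionRing.injective _ _
  have hA : ∀ U V U' V', A (U * V - U' * V') = A U * A V - A U' * A V' := fun U V U' V' => by
    rw [map_sub, map_mul, map_mul]
  let v := p₀.rep
  -- The factor `a i * X i ^ d / X i ^ N` has degree d - N and value 1 at `v`. As `T` vanishes
  -- there, every `s i` has the jet `w` at `p₀`. If `v i = 0`, the point is outside chart `i` and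
  -- the value of `a i` is irrelevant.
  let a : Fin (n + 1) → 𝕜 := fun i => v i ^ N / v i ^ d
  let G : Fin (n + 1) → CoordRing 𝕜 n := fun i =>
    T * (MvPolynomial.C (a i) * MvPolynomial.X i ^ d)
  let s : Fin (n + 1) → FractionRing (CoordRing 𝕜 n) := fun i =>
    A (G i) / A (MvPolynomial.X i ^ N)
  have hX : ∀ (i : Fin (n + 1)) (k : ℕ), A (MvPolynomial.X i ^ k) ≠ 0 := fun i k =>
    (map_ne_zero_iff _ hinj).2 (pow_ne_zero _ (MvPolynomial.X_ne_zero i))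
  have hs : ∀ i, s i * A (MvPolynomial.X i ^ N) = A (G i) := fun i => div_mul_cancel₀ _ (hX i N)
  have hXhom : ∀ (i : Fin (n + 1)) (k : ℕ),
      (MvPolynomial.X i ^ k : CoordRing 𝕜 n).IsHomogeneous k := fun i k =>
    MvPolynomial.isHomogeneous_X_pow i k
  have hGhom : ∀ i, (G i).IsHomogeneous (N + (0 + d)) := fun i =>
    hT.mul ((MvPolynomial.isHomogeneous_C _ _).mul (hXhom i d))
  have hcocycle : (fun i j => s j - s i) ∈ cocycles S d := by
    refine ⟨fun i j => ?_, fun i j k => by ring⟩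
    rcases eq_or_ne i j with rfl | hij
    · simp only [sub_self]
      exact Submodule.zero_mem _
    refine ⟨N, G j * MvPolynomial.X i ^ N - G i * MvPolynomial.X j ^ N, mem_doubleForms.2 ⟨?_, ?_⟩,
      ?_⟩
    · rw [Finset.card_pair hij, show d + N * 2 = N + (0 + d) + N by ring]
      exact ((hGhom j).mul (hXhom i N)).sub ((hGhom i).mul (hXhom j N))
    · rintro p ⟨hpS, hp⟩
      have hpi := hp i (by simp)
      have hpj := hp j (by simp)
      have he : G j * MvPolynomial.X i ^ N - G i * MvPolynomial.X j ^ N =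
          T * (MvPolynomial.C (a j) * MvPolynomial.X j ^ d * MvPolynomial.X i ^ N -
            MvPolynomial.C (a i) * MvPolynomial.X i ^ d * MvPolynomial.X j ^ N) := by
        simp only [G]
        ring
      rw [he]
      rcases eq_or_ne p p₀ with rfl | hpp
      -- At `p₀` both factors vanish, the second by the choice of `a`, so the difference of local
      -- sections is singular.
      · refine isSingularAt_mul hT₀ ?_
        simp only [map_sub, map_mul, map_pow, MvPolynomial.eval_C, MvPolynomial.eval_X, a, v]
        field_simp
        ring
      · exact (hTS p hpS hpp).mul_right _
    · have hM : A (chartMonomial 𝕜 {i, j} ^ N) =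
          A (MvPolynomial.X i ^ N) * A (MvPolynomial.X j ^ N) := by
        rw [chartMonomial, Finset.prod_pair hij, mul_pow, map_mul]
      have hD : A (G j * MvPolynomial.X i ^ N - G i * MvPolynomial.X j ^ N) =
          A (G j) * A (MvPolynomial.X i ^ N) - A (G i) * A (MvPolynomial.X j ^ N) := hA _ _ _ _
      refine (congrArg _ hM).trans (Eq.trans ?_ hD.symm)
      rw [← hs i, ← hs j]
      ring
  rw [h1, rank_pos_iff_nontrivial, Submodule.Quotient.nontrivial_iff]
  intro htop
  have hmem : (⟨_, hcocycle⟩ : cocycles S d) ∈ (coboundaries S d).submoduleOf (cocycles S d) :=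
    htop ▸ Submodule.mem_top
  obtain ⟨h, hh, hg⟩ := Submodule.mem_comap.1 hmem
  choose M F hF hFh using hh
  -- If the cocycle is a coboundary, the corrected sections `s i - h i` agree and define a global
  -- section `Q` of degree `d`.
  have hr : ∀ i, s 0 - h 0 = s i - h i := fun i => by
    have : s i - s 0 = h i - h 0 := hg 0 i
    linear_combination -this
  let P : Fin (n + 1) → CoordRing 𝕜 n := fun i =>
    G i * MvPolynomial.X i ^ M i - F i * MvPolynomial.X i ^ N
  have hP : ∀ i, (s 0 - h 0) * A (MvPolynomial.X i ^ (N + M i)) = A (P i) := fun i => by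
    have h1 : h i * A (MvPolynomial.X i ^ M i) = A (F i) := by
      have := hFh i
      rwa [chartMonomial, Finset.prod_singleton] at this
    rw [hr i, pow_add, map_mul, hA, ← h1, ← hs i]
    ring
  -- Two different charts already force polynomiality; they exist because n ≥ 1.
  obtain ⟨Q, hQ⟩ := exists_eq_algebraMap (i := 0) (j := Fin.last n)
    (by rw [Ne, Fin.ext_iff, Fin.val_zero, Fin.val_last]; omega) (hP 0) (hP _)
  have hQP : ∀ i, Q * MvPolynomial.X i ^ (N + M i) = P i := fun i => by
    apply hinj
    rw [← hP i, map_mul, hQ]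
  have hF' : ∀ p ∈ S, ∀ i, p.rep i ≠ 0 → IsSingularAt (F i) p.rep := fun p hp i hi =>
    (mem_doubleForms.1 (hF i)).2 p ⟨hp, by simpa using hi⟩
  refine hobs Q ?_ (fun p hp hpp => ?_) ?_ ?_
  · refine isHomogeneous_of_mul_X_pow (i := 0) (a := N + M 0) ?_
    rw [hQP 0]
    refine MvPolynomial.IsHomogeneous.sub ?_ ?_
    · rw [show d + (N + M 0) = N + (0 + d) + M 0 by ring]
      exact (hGhom 0).mul (hXhom 0 _)
    · have := (mem_doubleForms.1 (hF 0)).1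
      rw [Finset.card_singleton, mul_one] at this
      rw [show d + (N + M 0) = d + M 0 + N by ring]
      exact this.mul (hXhom 0 _)
  · obtain ⟨i, hi⟩ := Function.ne_iff.1 p.rep_nonzero
    refine IsSingularAt.of_mul (G := MvPolynomial.X i ^ (N + M i)) ?_ (by
      rw [map_pow, MvPolynomial.eval_X]
      exact pow_ne_zero _ hi)
    rw [hQP i]
    exact (((hTS p hp hpp).mul_right _).mul_right _).sub ((hF' p hp i hi).mul_right _)
  -- In a chart containing `p₀` the correction `h i` is singular there, so `Q` has the same jet as
  -- `s i`, namely `w`, against the obstruction.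
  all_goals
    obtain ⟨i, hi⟩ := Function.ne_iff.1 p₀.rep_nonzero
    have hsing := hF' p₀ hp₀ i hi
    have hv : p₀.rep i ^ (N + M i) ≠ 0 := pow_ne_zero _ hi
    have hQ₀ : MvPolynomial.eval p₀.rep Q = 0 := by
      have := congrArg (MvPolynomial.eval p₀.rep) (hQP i)
      simp only [P, G, map_sub, map_mul, hT₀, hsing.1, zero_mul, sub_self, map_pow,
        MvPolynomial.eval_X] at this
      exact (mul_eq_zero.1 this).resolve_right hv
  · exact hQ₀
  · intro j
    have := congrArg (fun R => MvPolynomial.eval p₀.rep (MvPolynomial.pderiv j R)) (hQP i)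
    simp only [P, G, map_sub, map_add, map_mul, Derivation.leibniz, smul_eq_mul, hT₀, hTw, hQ₀,
      hsing.1, hsing.2, zero_mul, mul_zero, sub_zero, zero_add, add_zero, map_pow,
      MvPolynomial.eval_X, MvPolynomial.eval_C, a, v] at this
    have hi' : p₀.rep i ≠ 0 := hi
    apply mul_left_cancel₀ hv
    rw [this]
    field_simp
    ring

end Cohomology

/-! ### Properties of the collinear locus, assembled. -/

section CollinearLocus

variable {𝕜 : Type*} [Field 𝕜] {n x : ℕ}

lemma collinearLocus_subset_terraciniLocus [CharZero 𝕜] {c d : ℕ} (hn : 1 ≤ n) (hd : d ≠ 0)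
    (hc : 1 ≤ c) (hdc : d ≤ 2 * c) (hx : (n + 1) * x ≤ (n + d).choose n) :
    collinearLocus 𝕜 n x c ⊆ terraciniLocus 𝕜 n d x := by
  rintro S ⟨hs, hS⟩
  obtain ⟨p₀, hp₀, w, hw, hobs⟩ := exists_jet_obstruction hc hdc hS
  exact ⟨hs, h0_pos_of_containsCollinear hd hc hdc hS (by rwa [S.2]),
    h1_pos_of_jet_obstruction hn hp₀ hw hobs⟩

lemma isClosed_setOf_containsCollinear {c : ℕ} (hc : 1 ≤ c) (hcx : c + 1 ≤ x) :
    IsClosed {S : PointSets 𝕜 n x | ContainsCollinear S.1 (c + 1)} := by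
  rw [setOf_containsCollinear_eq (i₀ := ⟨0, by omega⟩) (i₁ := ⟨1, by omega⟩) (by simp)
    (Nat.zero_le _) hc hcx]
  exact isClosedMap_forgetOrder _ ((isClosed_collinearTuples _ _ _).preimage continuous_subtype_val)

lemma isIrreducible_collinearLocus [CharZero 𝕜] {c : ℕ} (hn : 1 ≤ n) (hc : 1 ≤ c)
    (hcx : n + c ≤ x) : IsIrreducible (collinearLocus 𝕜 n x c) := by
  have h₀₁ : (⟨0, by omega⟩ : Fin x) ≠ ⟨1, by omega⟩ := by simp
  rw [collinearLocus_eq h₀₁ (Nat.zero_le _) hc (by omega)]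
  exact isIrreducible_image_forgetOrder
    ⟨⟨_, affineTuple_mem_collinearTuples (Nat.zero_le _) le_rfl h₀₁ (momentParam 𝕜 n x c) ⟨0, hn⟩,
      mkTuple_momentParam_mem_spanningTuples hc hcx rfl rfl ⟨0, hn⟩⟩,
      isPreirreducible_collinearTuples h₀₁ (Nat.zero_le _) hc⟩
    fun p hp => hp.2.1

end CollinearLocus

end Terracini

end

theorem theorem3p8 {𝕜 : Type*} [Field 𝕜] [IsAlgClosed 𝕜] [CharZero 𝕜]
    (n d x : ℕ) (hn : 2 ≤ n) (hd : 3 ≤ d)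
    (hx : n + ⌈(d : ℚ) / 2⌉₊ ≤ x) (hx' : (n + 1) * x ≤ (n + d).choose n) :
    ∃ K : Set (Terracini.PointSets 𝕜 n x),
      K ⊆ Terracini.terraciniLocus 𝕜 n d x ∧
      (∃ C : Set (Terracini.PointSets 𝕜 n x),
        IsClosed C ∧ K = C ∩ Terracini.terraciniLocus 𝕜 n d x) ∧
      IsLocallyClosed K ∧
      IsIrreducible K ∧
      (∀ S : Terracini.PointSets 𝕜 n x, S ∈ K ↔
        Terracini.Spans S.1 ∧ Terracini.ContainsCollinear S.1 (⌈(d : ℚ) / 2⌉₊ + 1)) ∧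
      Terracini.HasSpread K (x - ⌈(d : ℚ) / 2⌉₊ + 1) ∧
      topologicalKrullDim K =
        ((⌈(d : ℚ) / 2⌉₊ + n - 1 + n * (x - ⌈(d : ℚ) / 2⌉₊) : ℕ) : WithBot ℕ∞) := by
  have hdc : d ≤ 2 * ⌈(d : ℚ) / 2⌉₊ := by
    have h := Nat.le_ceil ((d : ℚ) / 2)
    rw [div_le_iff₀ two_pos] at h
    rw [mul_comm]
    exact_mod_cast h
  -- From here on only `d ≤ 2 * c` is remembered about `c`.
  generalize ⌈(d : ℚ) / 2⌉₊ = c at *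
  have hc : 1 ≤ c := by omega
  have hsub := Terracini.collinearLocus_subset_terraciniLocus (𝕜 := 𝕜) (by omega : 1 ≤ n)
    (by omega) hc hdc hx'
  have hclosed := Terracini.isClosed_setOf_containsCollinear (𝕜 := 𝕜) (n := n) hc
    (by omega : c + 1 ≤ x)
  refine ⟨Terracini.collinearLocus 𝕜 n x c, hsub, ⟨_, hclosed, ?_⟩,
    Terracini.isOpen_spans.isLocallyClosed.inter hclosed.isLocallyClosed,
    Terracini.isIrreducible_collinearLocus (by omega) hc hx, fun S => Iff.rfl,
    Terracini.hasSpread_collinearLocus hn hc hx,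
    le_antisymm (Terracini.topologicalKrullDim_collinearLocus_le (by omega) hc (by omega))
      (Terracini.le_topologicalKrullDim_collinearLocus (by omega) hc hx)⟩
  -- Spanning is part of the Terracini condition, so within that locus `K` is cut out by
  -- collinearity alone.
  exact Set.Subset.antisymm (fun S hS => ⟨hS.2, hsub hS⟩) fun S hS => ⟨hS.2.1, hS.1⟩
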